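/- A triple system is a $3$-uniform hypergraph without repeated edges; its vertices and edges are called points and triples. It is linear if any two distinct triples share at most one point. For a family $\mathcal F$ of triple systems, $\mathrm{ex}(n,\mathcal F)$ denotes the maximum number of triples in a triple system on $n$ points that contains no member of $\mathcal F$ as a (not necessarily induced) subhypergraph, and $\mathrm{ex}_{\rm lin}(n,\mathcal F)$ denotes the maximum number of triples in a linear triple system on $n$ points that contains no member of $\mathcal F$; for a one-element family we omit the braces. Define the linear triple systems $$F^3=\{123,345,156,367\},\qquad P=\{123,345,156,246\},\qquad C_{14}=\{123,345,156,267\},$$ and let $F(7,4)$ be the family of all triple systems with exactly four triples on at most seven points. Theorem. The following hold. (1) $\mathrm{ex}_{\rm lin}(n,P)=n(n-1)/6$ for infinitely many $n$. (2) $\mathrm{ex}_{\rm lin}(n,C_{14})=n(n-1)/6$ for infinitely many $n$. (3) $\mathrm{ex}_{\rm lin}(n,F^3)=n^2/9$ for every $n$ divisible by $3$. (4) $\mathrm{ex}_{\rm lin}(n,\{F^3,P\})=n^2/9$ for infinitely many $n$. (5) $\mathrm{ex}_{\rm lin}(n,\{F^3,C_{14}\})=n^2/9$ for infinitely many $n$.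 (6) For every $n$, $$\mathrm{ex}(n,F(7,4))-\tfrac12 n\le \mathrm{ex}_{\rm lin}(n,\{F^3,P,C_{14}\})\le \mathrm{ex}_{\rm lin}(n,\{P,C_{14}\})\le \tfrac92\,\mathrm{ex}(n,F(7,4)).$$ -/

import Mathlib

open scoped Hypergraph

namespace Hypergraph

/-- Every edge has exactly `k` vertices. -/
def IsUniform {α : Type*} (H : Hypergraph α) (k : ℕ) : Prop :=
  ∀ e ∈ E(H), e.encard = k

/-- Any two distinct edges meet in at most one vertex. -/
def IsLinear {α : Type*} (H : Hypergraph α) : Prop :=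
  ∀ e ∈ E(H), ∀ f ∈ E(H), e ≠ f → (e ∩ f).encard ≤ 1

/-- `H` contains (a copy of) `G` as a subhypergraph, not necessarily an induced one: some map of
vertices that is injective on the vertex set of `G` sends edges of `G` to edges of `H`. -/
def Contains {α β : Type*} (H : Hypergraph α) (G : Hypergraph β) : Prop :=
  ∃ φ : β → α, Set.MapsTo φ V(G) V(H) ∧ Set.InjOn φ V(G) ∧ ∀ e ∈ E(G), φ '' e ∈ E(H)

/-- `H` contains no member of the family `F`. -/
def IsFree {α β : Type*} (H : Hypergraph α) (F : Set (Hypergraph β)) : Prop :=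
  ∀ G ∈ F, ¬ H.Contains G

end Hypergraph

/-- The Turán number: the maximum number of edges of a `k`-uniform `F`-free hypergraph on
`n` vertices. -/
noncomputable def turanNumber {β : Type*} (k n : ℕ) (F : Set (Hypergraph β)) : ℕ :=
  sSup {m | ∃ H : Hypergraph (Fin n), V(H) = Set.univ ∧ H.IsUniform k ∧ H.IsFree F ∧
    E(H).ncard = m}

/-- The linear Turán number: the maximum number of edges of a `k`-uniform linear `F`-free
hypergraph on `n` vertices. -/
noncomputable def linearTuranNumber {β : Type*} (k n : ℕ) (F : Set (Hypergraph β)) : ℕ :=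
  sSup {m | ∃ H : Hypergraph (Fin n), V(H) = Set.univ ∧ H.IsUniform k ∧ H.IsLinear ∧ H.IsFree F ∧
    E(H).ncard = m}

/-- The `3`-fan (sail) `F³`: the triples `312`, `345`, `367` through the center `3`, and the
crossing triple `156`. -/
def fan3 : Hypergraph ℕ where
  vertexSet := Set.Icc 1 7
  edgeSet := {{1, 2, 3}, {3, 4, 5}, {1, 5, 6}, {3, 6, 7}}
  subset_vertexSet_of_mem_edgeSet' := by
    rintro e (rfl | rfl | rfl | rfl) x hx <;> simp at hx <;> simp <;> omega

/-- The Pasch configuration `P`. -/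
def pasch : Hypergraph ℕ where
  vertexSet := Set.Icc 1 6
  edgeSet := {{1, 2, 3}, {3, 4, 5}, {1, 5, 6}, {2, 4, 6}}
  subset_vertexSet_of_mem_edgeSet' := by
    rintro e (rfl | rfl | rfl | rfl) x hx <;> simp at hx <;> simp <;> omega

/-- The configuration `C₁₄`. -/
def config14 : Hypergraph ℕ where
  vertexSet := Set.Icc 1 7
  edgeSet := {{1, 2, 3}, {3, 4, 5}, {1, 5, 6}, {2, 6, 7}}
  subset_vertexSet_of_mem_edgeSet' := by
    rintro e (rfl | rfl | rfl | rfl) x hx <;> simp at hx <;> simp <;> omega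

/-- `F(7,4)`: the triple systems with four triples on at most seven points. -/
def fourTriplesSevenPoints : Set (Hypergraph ℕ) :=
  {G | G.IsUniform 3 ∧ V(G).encard ≤ 7 ∧ E(G).encard = 4}

/-! Parts (1) and (2): a Steiner triple system attains the trivial bound n(n-1)/6, so it suffices to
find Steiner systems avoiding the configuration. In the lines of affine space over 𝔽₃, adding the
four equations of a Pasch with suitable signs gives 2c = 2f, which merges two of its points. In the
lines of projective space over 𝔽₂, the same trick applied to `C₁₄` gives d = g.

Parts (3) to (5): if a linear system has no fan, no point outside a triple is joined to all three of
its points. Hence the degrees along a triple sum to at most n. Summing over all triples and applying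
Cauchy–Schwarz gives 9|T| ≤ n² (`nine_mul_card_le`). Equality holds for the transversal design x + y
+ z = 0 over a group of order n/3. It is 3-partite, and the fan is not. Over 𝔽₃ᵏ it also avoids
Pasch, and over 𝔽₂ᵏ it avoids `C₁₄`, by the identities above.

Part (6), lower bound: fan, Pasch and `C₁₄` all have four triples on at most seven points, so a
system with no such four triples only has to be made linear. A largest linear subsystem loses at
most n/2 triples (`exists_partialLinear_subset`). Upper bound: a random 3-colouring makes 2/9 of the
triples rainbow on average. In a 3-partite linear system, four triples on seven points always form a
Pasch or a `C₁₄` (`HasFourOnSeven.hasPasch_or_hasConfig14`), so the rainbow part is `F(7,4)`-free.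
-/

/-- The hypergraph on all of `α` whose edges are the members of `T`. -/
def Hypergraph.ofFinsets {α : Type*} (T : Finset (Finset α)) : Hypergraph α where
  vertexSet := Set.univ
  edgeSet := (fun e : Finset α => (e : Set α)) '' (T : Set (Finset α))
  subset_vertexSet_of_mem_edgeSet' := fun _ _ => Set.subset_univ _

/-- All members of `T` have three points. -/
def IsTripleSystem {α : Type*} (T : Finset (Finset α)) : Prop := ∀ e ∈ T, e.card = 3

/-- Two points lie in at most one member of `T`. -/
def IsPartialLinear {α : Type*} (T : Finset (Finset α)) : Prop :=
  ∀ e ∈ T, ∀ f ∈ T, ∀ a b, a ≠ b → a ∈ e → b ∈ e → a ∈ f → b ∈ f → e = f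

/-- `T` contains a Pasch configuration. -/
def HasPasch {α : Type*} [DecidableEq α] (T : Finset (Finset α)) : Prop :=
  ∃ a b c d e f : α, [a, b, c, d, e, f].Nodup ∧
    {a, b, c} ∈ T ∧ {c, d, e} ∈ T ∧ {a, e, f} ∈ T ∧ {b, d, f} ∈ T

/-- `T` contains a copy of `C₁₄`. -/
def HasConfig14 {α : Type*} [DecidableEq α] (T : Finset (Finset α)) : Prop :=
  ∃ a b c d e f g : α, [a, b, c, d, e, f, g].Nodup ∧
    {a, b, c} ∈ T ∧ {c, d, e} ∈ T ∧ {a, e, f} ∈ T ∧ {b, f, g} ∈ T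

/-- `T` contains a `3`-fan. -/
def HasFan3 {α : Type*} [DecidableEq α] (T : Finset (Finset α)) : Prop :=
  ∃ a b c d e f g : α, [a, b, c, d, e, f, g].Nodup ∧
    {a, b, c} ∈ T ∧ {c, d, e} ∈ T ∧ {a, e, f} ∈ T ∧ {c, f, g} ∈ T

/-- `T` has four members spanning at most seven points. -/
def HasFourOnSeven {α : Type*} [DecidableEq α] (T : Finset (Finset α)) : Prop :=
  ∃ S ⊆ T, S.card = 4 ∧ (S.biUnion id).card ≤ 7

/-! ### Translation between hypergraphs and finite sets of triples -/

namespace Hypergraph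

variable {α : Type*} {T : Finset (Finset α)}

lemma mem_edgeSet_ofFinsets {s : Set α} : s ∈ E(ofFinsets T) ↔ ∃ e ∈ T, (e : Set α) = s := by
  simp [ofFinsets]

lemma coe_mem_edgeSet_ofFinsets {e : Finset α} : (e : Set α) ∈ E(ofFinsets T) ↔ e ∈ T := by
  simp [mem_edgeSet_ofFinsets]

lemma ncard_edgeSet_ofFinsets : E(ofFinsets T).ncard = T.card := by
  rw [ofFinsets, Set.ncard_image_of_injective _ Finset.coe_injective, Set.ncard_coe_finset]

lemma exists_eq_ofFinsets [Fintype α] {H : Hypergraph α} (hV : V(H) = Set.univ) :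
    ∃ T : Finset (Finset α), H = ofFinsets T := by
  classical
  refine ⟨Finset.univ.filter fun e => (e : Set α) ∈ E(H), ?_⟩
  ext s
  · simp [hV, ofFinsets]
  · simp only [mem_edgeSet_ofFinsets, Finset.mem_filter, Finset.mem_univ, true_and]
    constructor
    · intro hs
      exact ⟨(Set.toFinite s).toFinset, by simpa using hs, by simp⟩
    · rintro ⟨e, he, rfl⟩
      exact he

lemma isUniform_ofFinsets : (ofFinsets T).IsUniform 3 ↔ IsTripleSystem T := by
  simp only [IsUniform, IsTripleSystem, mem_edgeSet_ofFinsets]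
  constructor
  · intro h e he
    have := h e ⟨e, he, rfl⟩
    rw [Set.encard_coe_eq_coe_finsetCard] at this
    exact_mod_cast this
  · rintro h _ ⟨e, he, rfl⟩
    rw [Set.encard_coe_eq_coe_finsetCard, h e he]

lemma isLinear_ofFinsets : (ofFinsets T).IsLinear ↔ IsPartialLinear T := by
  simp only [IsLinear, IsPartialLinear, mem_edgeSet_ofFinsets, Set.encard_le_one_iff]
  constructor
  · intro h e he f hf a b hab hae hbe haf hbf
    by_contra hef
    exact hab (h e ⟨e, he, rfl⟩ f ⟨f, hf, rfl⟩ (by simpa using hef) a b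
      ⟨by simpa using hae, by simpa using haf⟩ ⟨by simpa using hbe, by simpa using hbf⟩)
  · rintro h _ ⟨e, he, rfl⟩ _ ⟨f, hf, rfl⟩ hef a b ha hb
    by_contra hab
    exact hef (congrArg _ (h e he f hf a b hab (by simpa using ha.1) (by simpa using hb.1)
      (by simpa using ha.2) (by simpa using hb.2)))

/-- Free-ness is invariant under relabelling of the points. -/
lemma IsFree.ofFinsets_image {β γ : Type*} [DecidableEq γ] (e : α ≃ γ) {F : Set (Hypergraph β)}
    (h : (ofFinsets T).IsFree F) : (ofFinsets (T.image (Finset.image e))).IsFree F := by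
  rintro G hG ⟨φ, -, hinj, he⟩
  refine h G hG ⟨e.symm ∘ φ, fun _ _ => Set.mem_univ _, e.symm.injective.comp_injOn hinj, ?_⟩
  intro s hs
  obtain ⟨t, ht, hts⟩ := mem_edgeSet_ofFinsets.1 (he s hs)
  obtain ⟨u, hu, rfl⟩ := Finset.mem_image.1 ht
  refine mem_edgeSet_ofFinsets.2 ⟨u, hu, ?_⟩
  rw [Set.image_comp, ← hts]
  simp [Set.image_image]

variable [DecidableEq α]

lemma image_triple_mem_edgeSet_ofFinsets {φ : ℕ → α} {i j k : ℕ} :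
    φ '' {i, j, k} ∈ E(ofFinsets T) ↔ {φ i, φ j, φ k} ∈ T := by
  rw [← coe_mem_edgeSet_ofFinsets]
  simp [Set.image_insert_eq]

lemma contains_pasch : (ofFinsets T).Contains pasch ↔ HasPasch T := by
  constructor
  · rintro ⟨φ, -, hinj, he⟩
    have key : ∀ i j : ℕ, i ∈ Set.Icc 1 6 → j ∈ Set.Icc 1 6 → i ≠ j → φ i ≠ φ j :=
      fun i j hi hj hij h => hij (hinj hi hj h)
    simp only [pasch, Set.mem_insert_iff, Set.mem_singleton_iff, forall_eq_or_imp, forall_eq,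
      image_triple_mem_edgeSet_ofFinsets] at he
    refine ⟨φ 1, φ 2, φ 3, φ 4, φ 5, φ 6, ?_, he⟩
    simp only [List.nodup_cons, List.mem_cons, List.not_mem_nil, or_false, not_or,
      List.nodup_nil, not_false_eq_true, and_true]
    refine ⟨⟨?_, ?_, ?_, ?_, ?_⟩, ⟨?_, ?_, ?_, ?_⟩, ⟨?_, ?_, ?_⟩, ⟨?_, ?_⟩, ?_⟩ <;>
      exact key _ _ (by simp) (by simp) (by simp)
  · rintro ⟨a, b, c, d, e, f, hnd, he⟩
    -- Labels start at 1 and list positions at 0, hence `i - 1`. The default `a` is never reached on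
    -- the vertex set.
    refine ⟨fun i => [a, b, c, d, e, f].getD (i - 1) a, fun _ _ => Set.mem_univ _, ?_, ?_⟩
    · intro i hi j hj hij
      simp only [pasch, Set.mem_Icc] at hi hj
      simp only at hij
      rw [List.getD_eq_getElem _ _ (by simp; omega), List.getD_eq_getElem _ _ (by simp; omega),
        hnd.getElem_inj_iff] at hij
      omega
    · simp only [pasch, Set.mem_insert_iff, Set.mem_singleton_iff, forall_eq_or_imp, forall_eq,
        image_triple_mem_edgeSet_ofFinsets]
      exact he

lemma contains_config14 : (ofFinsets T).Contains config14 ↔ HasConfig14 T := by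
  constructor
  · rintro ⟨φ, -, hinj, he⟩
    have key : ∀ i j : ℕ, i ∈ Set.Icc 1 7 → j ∈ Set.Icc 1 7 → i ≠ j → φ i ≠ φ j :=
      fun i j hi hj hij h => hij (hinj hi hj h)
    simp only [config14, Set.mem_insert_iff, Set.mem_singleton_iff, forall_eq_or_imp, forall_eq,
      image_triple_mem_edgeSet_ofFinsets] at he
    refine ⟨φ 1, φ 2, φ 3, φ 4, φ 5, φ 6, φ 7, ?_, he⟩
    simp only [List.nodup_cons, List.mem_cons, List.not_mem_nil, or_false, not_or,
      List.nodup_nil, not_false_eq_true, and_true]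
    refine ⟨⟨?_, ?_, ?_, ?_, ?_, ?_⟩, ⟨?_, ?_, ?_, ?_, ?_⟩, ⟨?_, ?_, ?_, ?_⟩, ⟨?_, ?_, ?_⟩,
      ⟨?_, ?_⟩, ?_⟩ <;> exact key _ _ (by simp) (by simp) (by simp)
  · rintro ⟨a, b, c, d, e, f, g, hnd, he⟩
    refine ⟨fun i => [a, b, c, d, e, f, g].getD (i - 1) a, fun _ _ => Set.mem_univ _, ?_, ?_⟩
    · intro i hi j hj hij
      simp only [config14, Set.mem_Icc] at hi hj
      simp only at hij
      rw [List.getD_eq_getElem _ _ (by simp; omega), List.getD_eq_getElem _ _ (by simp; omega),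
        hnd.getElem_inj_iff] at hij
      omega
    · simp only [config14, Set.mem_insert_iff, Set.mem_singleton_iff, forall_eq_or_imp, forall_eq,
        image_triple_mem_edgeSet_ofFinsets]
      exact he

lemma contains_fan3 : (ofFinsets T).Contains fan3 ↔ HasFan3 T := by
  constructor
  · rintro ⟨φ, -, hinj, he⟩
    have key : ∀ i j : ℕ, i ∈ Set.Icc 1 7 → j ∈ Set.Icc 1 7 → i ≠ j → φ i ≠ φ j :=
      fun i j hi hj hij h => hij (hinj hi hj h)
    simp only [fan3, Set.mem_insert_iff, Set.mem_singleton_iff, forall_eq_or_imp, forall_eq,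
      image_triple_mem_edgeSet_ofFinsets] at he
    refine ⟨φ 1, φ 2, φ 3, φ 4, φ 5, φ 6, φ 7, ?_, he⟩
    simp only [List.nodup_cons, List.mem_cons, List.not_mem_nil, or_false, not_or,
      List.nodup_nil, not_false_eq_true, and_true]
    refine ⟨⟨?_, ?_, ?_, ?_, ?_, ?_⟩, ⟨?_, ?_, ?_, ?_, ?_⟩, ⟨?_, ?_, ?_, ?_⟩, ⟨?_, ?_, ?_⟩,
      ⟨?_, ?_⟩, ?_⟩ <;> exact key _ _ (by simp) (by simp) (by simp)
  · rintro ⟨a, b, c, d, e, f, g, hnd, he⟩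
    refine ⟨fun i => [a, b, c, d, e, f, g].getD (i - 1) a, fun _ _ => Set.mem_univ _, ?_, ?_⟩
    · intro i hi j hj hij
      simp only [fan3, Set.mem_Icc] at hi hj
      simp only at hij
      rw [List.getD_eq_getElem _ _ (by simp; omega), List.getD_eq_getElem _ _ (by simp; omega),
        hnd.getElem_inj_iff] at hij
      omega
    · simp only [fan3, Set.mem_insert_iff, Set.mem_singleton_iff, forall_eq_or_imp, forall_eq,
        image_triple_mem_edgeSet_ofFinsets]
      exact he

lemma isFree_fourTriplesSevenPoints_of_not {T : Finset (Finset α)} (h : ¬ HasFourOnSeven T) :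
    (ofFinsets T).IsFree fourTriplesSevenPoints := by
  classical
  rintro G ⟨-, hV, hE⟩ ⟨φ, -, hinj, he⟩
  have hVfin : V(G).Finite := Set.finite_of_encard_le_coe (k := 7) hV
  have hsub : ∀ e ∈ E(G), e ⊆ V(G) := fun e he => G.subset_vertexSet_of_mem_edgeSet' he
  have hEfin : E(G).Finite := Set.finite_of_encard_le_coe (k := 4) hE.le
  choose! t ht hts using fun e (h : e ∈ E(G)) => mem_edgeSet_ofFinsets.1 (he e h)
  refine h ⟨hEfin.toFinset.image t, ?_, ?_, ?_⟩
  · intro e he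
    obtain ⟨s, hs, rfl⟩ := Finset.mem_image.1 he
    exact ht s (by simpa using hs)
  · rw [Finset.card_image_of_injOn]
    · rw [hEfin.encard_eq_coe_toFinset_card] at hE
      exact_mod_cast hE
    · intro s hs s' hs' hss
      have hs : s ∈ E(G) := by simpa using hs
      have hs' : s' ∈ E(G) := by simpa using hs'
      apply (hinj.image_eq_image_iff (hsub s hs) (hsub s' hs')).1
      rw [← hts s hs, ← hts s' hs', hss]
  · have h1 : ((hEfin.toFinset.image t).biUnion id) ⊆ hVfin.toFinset.image φ := by
      intro x hx
      simp only [Finset.mem_biUnion, Finset.mem_image, Set.Finite.mem_toFinset, id] at hx ⊢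
      obtain ⟨_, ⟨s, hs, rfl⟩, hx⟩ := hx
      have : x ∈ φ '' s := by rw [← hts s hs]; exact hx
      obtain ⟨y, hy, rfl⟩ := this
      exact ⟨y, hsub s hs hy, rfl⟩
    refine (Finset.card_le_card h1).trans (Finset.card_image_le.trans ?_)
    rw [hVfin.encard_eq_coe_toFinset_card] at hV
    exact_mod_cast hV

/-- The forbidden family lives on ℕ, so the four triples are copied there along `Fin.val`, and the
inverse of `Fin.val` embeds the copy back. -/
lemma not_hasFourOnSeven_of_isFree {n : ℕ} {T : Finset (Finset (Fin n))} (hT : IsTripleSystem T)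
    (h : (ofFinsets T).IsFree fourTriplesSevenPoints) : ¬ HasFourOnSeven T := by
  rintro ⟨S, hST, hS4, hS7⟩
  let G : Hypergraph ℕ := 
    { vertexSet := ((S.biUnion id).image Fin.val : Finset ℕ)
      edgeSet := (fun e : Finset (Fin n) => ((e.image Fin.val : Finset ℕ) : Set ℕ)) '' S
      subset_vertexSet_of_mem_edgeSet' := by
        rintro _ ⟨e, he, rfl⟩
        exact Finset.coe_subset.2 (Finset.image_subset_image
          (Finset.subset_biUnion_of_mem id he)) }
  have hcard : ∀ e : Finset (Fin n), (e.image Fin.val).card = e.card :=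
    fun e => Finset.card_image_of_injective _ Fin.val_injective
  refine h G ⟨?_, ?_, ?_⟩ ?_
  · rintro _ ⟨e, he, rfl⟩
    simp only [Set.encard_coe_eq_coe_finsetCard, hcard, hT e (hST he)]
  · change (((S.biUnion id).image Fin.val : Finset ℕ) : Set ℕ).encard ≤ 7
    rw [Set.encard_coe_eq_coe_finsetCard, hcard]
    exact_mod_cast hS7
  · change ((fun e : Finset (Fin n) => ((e.image Fin.val : Finset ℕ) : Set ℕ)) '' S).encard = 4
    rw [Function.Injective.encard_image, Set.encard_coe_eq_coe_finsetCard, hS4]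
    · rfl
    · exact Finset.coe_injective.comp (Finset.image_injective Fin.val_injective)
  -- A point of some triple is needed only to make `Fin n` nonempty, as `Function.invFun` requires.
  · obtain ⟨e, he⟩ := Finset.card_pos.1 (by omega : 0 < S.card)
    obtain ⟨x, hx⟩ := Finset.card_pos.1 (by rw [hT e (hST he)]; omega : 0 < e.card)
    have : Nonempty (Fin n) := ⟨x⟩
    have hl : ∀ x : Fin n, Function.invFun Fin.val x.val = x :=
      Function.leftInverse_invFun Fin.val_injective
    refine ⟨Function.invFun Fin.val, fun _ _ => Set.mem_univ _, ?_, ?_⟩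
    · intro i hi j hj hij
      obtain ⟨i, -, rfl⟩ := Finset.mem_image.1 (Finset.mem_coe.1 hi)
      obtain ⟨j, -, rfl⟩ := Finset.mem_image.1 (Finset.mem_coe.1 hj)
      rw [hl, hl] at hij
      rw [hij]
    · rintro _ ⟨e, he, rfl⟩
      refine mem_edgeSet_ofFinsets.2 ⟨e, hST he, ?_⟩
      simp [Set.image_image, hl]

end Hypergraph

open Hypergraph

/-! ### Extremal numbers as suprema over finite triple systems -/

section ExtremalNumbers

variable {β : Type*} {F : Set (Hypergraph β)}

lemma linearTuranNumber_le {n m : ℕ}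
    (h : ∀ T : Finset (Finset (Fin n)), IsTripleSystem T → IsPartialLinear T →
      (ofFinsets T).IsFree F → T.card ≤ m) : linearTuranNumber 3 n F ≤ m := by
  refine csSup_le' ?_
  rintro _ ⟨H, hV, hU, hL, hF, rfl⟩
  obtain ⟨T, rfl⟩ := exists_eq_ofFinsets hV
  rw [ncard_edgeSet_ofFinsets]
  exact h T (isUniform_ofFinsets.1 hU) (isLinear_ofFinsets.1 hL) hF

lemma turanNumber_le {n m : ℕ}
    (h : ∀ T : Finset (Finset (Fin n)), IsTripleSystem T →
      (ofFinsets T).IsFree F → T.card ≤ m) : turanNumber 3 n F ≤ m := by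
  refine csSup_le' ?_
  rintro _ ⟨H, hV, hU, hF, rfl⟩
  obtain ⟨T, rfl⟩ := exists_eq_ofFinsets hV
  rw [ncard_edgeSet_ofFinsets]
  exact h T (isUniform_ofFinsets.1 hU) hF

lemma card_le_turanNumber {n : ℕ} {T : Finset (Finset (Fin n))} (hT : IsTripleSystem T)
    (hF : (ofFinsets T).IsFree F) : T.card ≤ turanNumber 3 n F := by
  -- The number of all subsets of the point set bounds every edge count, so the supremum is over a
  -- bounded set.
  refine le_csSup ⟨(Set.univ : Set (Set (Fin n))).ncard, ?_⟩ ⟨ofFinsets T, rfl,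
    isUniform_ofFinsets.2 hT, hF, ncard_edgeSet_ofFinsets⟩
  rintro _ ⟨H, -, -, -, rfl⟩
  exact Set.ncard_le_ncard (Set.subset_univ _)

lemma card_le_linearTuranNumber_fin {n : ℕ} {T : Finset (Finset (Fin n))} (hT : IsTripleSystem T)
    (hL : IsPartialLinear T) (hF : (ofFinsets T).IsFree F) : T.card ≤ linearTuranNumber 3 n F := by
  refine le_csSup ⟨(Set.univ : Set (Set (Fin n))).ncard, ?_⟩ ⟨ofFinsets T, rfl,
    isUniform_ofFinsets.2 hT, isLinear_ofFinsets.2 hL, hF, ncard_edgeSet_ofFinsets⟩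
  rintro _ ⟨H, -, -, -, -, rfl⟩
  exact Set.ncard_le_ncard (Set.subset_univ _)

lemma card_le_linearTuranNumber {α : Type*} [Fintype α] [DecidableEq α] {T : Finset (Finset α)}
    (hT : IsTripleSystem T) (hL : IsPartialLinear T) (hF : (ofFinsets T).IsFree F) :
    T.card ≤ linearTuranNumber 3 (Fintype.card α) F := by
  let e := Fintype.equivFin α
  have h1 : (T.image (Finset.image e)).card = T.card :=
    Finset.card_image_of_injective _ (Finset.image_injective e.injective)
  rw [← h1]
  refine card_le_linearTuranNumber_fin ?_ ?_ (hF.ofFinsets_image e)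
  · intro t ht
    obtain ⟨u, hu, rfl⟩ := Finset.mem_image.1 ht
    rw [Finset.card_image_of_injective _ e.injective, hT u hu]
  · intro s hs t ht a b hab has hbs hat hbt
    obtain ⟨s', hs', rfl⟩ := Finset.mem_image.1 hs
    obtain ⟨t', ht', rfl⟩ := Finset.mem_image.1 ht
    obtain ⟨a', ha', rfl⟩ := Finset.mem_image.1 has
    obtain ⟨b', hb', rfl⟩ := Finset.mem_image.1 hbs
    rw [hL s' hs' t' ht' a' b' (fun h => hab (h ▸ rfl)) ha' hb' (by simpa using hat)
      (by simpa using hbt)]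

end ExtremalNumbers

/-! ### Counting pairs of points covered by triples -/

section Counting

variable {α : Type*} [DecidableEq α] {T : Finset (Finset α)}

/-- Each triple covers six ordered pairs of distinct points, and linearity makes these sets of pairs
disjoint. -/
lemma card_biUnion_offDiag (hT : IsTripleSystem T) (hL : IsPartialLinear T) :
    (T.biUnion Finset.offDiag).card = 6 * T.card := by
  rw [Finset.card_biUnion]
  · rw [Finset.sum_congr rfl (g := fun _ => 6), Finset.sum_const, smul_eq_mul, mul_comm]
    intro e he
    rw [Finset.offDiag_card, hT e he]
  · intro e he f hf hef
    refine Finset.disjoint_left.2 ?_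
    rintro ⟨a, b⟩ h1 h2
    simp only [Finset.mem_offDiag] at h1 h2
    exact hef (hL e he f hf a b h1.2.2 h1.1 h1.2.1 h2.1 h2.2.1)

lemma six_mul_card_add_card_le [Fintype α] (hT : IsTripleSystem T) (hL : IsPartialLinear T) :
    6 * T.card + Fintype.card α ≤ Fintype.card α * Fintype.card α := by
  rw [← card_biUnion_offDiag hT hL]
  have h : (T.biUnion Finset.offDiag) ⊆ (Finset.univ : Finset α).offDiag :=
    Finset.biUnion_subset.2 fun e _ => Finset.offDiag_mono (Finset.subset_univ e)
  have := Finset.card_le_card h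
  rw [Finset.offDiag_card, Finset.card_univ] at this
  have := Nat.le_mul_self (Fintype.card α)
  omega

lemma six_mul_card_add_card_eq [Fintype α] (hT : IsTripleSystem T) (hL : IsPartialLinear T)
    (hcov : ∀ a b : α, a ≠ b → ∃ e ∈ T, a ∈ e ∧ b ∈ e) :
    6 * T.card + Fintype.card α = Fintype.card α * Fintype.card α := by
  rw [← card_biUnion_offDiag hT hL]
  have h : (T.biUnion Finset.offDiag) = (Finset.univ : Finset α).offDiag := by
    refine (Finset.biUnion_subset.2
      fun e _ => Finset.offDiag_mono (Finset.subset_univ e)).antisymm ?_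
    rintro ⟨a, b⟩ hab
    simp only [Finset.mem_offDiag, Finset.mem_univ, true_and] at hab
    obtain ⟨e, he, ha, hb⟩ := hcov a b hab
    exact Finset.mem_biUnion.2 ⟨e, he, Finset.mem_offDiag.2 ⟨ha, hb, hab⟩⟩
  rw [h, Finset.offDiag_card, Finset.card_univ]
  have := Nat.le_mul_self (Fintype.card α)
  omega

/-- The third point of a triple of size three containing two given points. -/
lemma exists_eq_triple_of_mem {e : Finset α} (he : e.card = 3) {a b : α} (hab : a ≠ b)
    (ha : a ∈ e) (hb : b ∈ e) : ∃ c, a ≠ c ∧ b ≠ c ∧ e = {a, b, c} := by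
  have h1 : ((e.erase a).erase b).card = 1 := by
    rw [Finset.card_erase_of_mem (Finset.mem_erase.2 ⟨hab.symm, hb⟩), Finset.card_erase_of_mem ha,
      he]
  obtain ⟨c, hc⟩ := Finset.card_eq_one.1 h1
  have hc' : c ∈ (e.erase a).erase b := by rw [hc]; exact Finset.mem_singleton_self c
  simp only [Finset.mem_erase] at hc'
  refine ⟨c, hc'.2.1.symm, hc'.1.symm, ?_⟩
  rw [← hc, Finset.insert_erase (Finset.mem_erase.2 ⟨hab.symm, hb⟩), Finset.insert_erase ha]

end Counting

/-! ### Affine spaces over 𝔽₃ and projective spaces over 𝔽₂ -/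

section Steiner

/-- A linear triple system covering all pairs attains the linear Turán number of any family it
avoids. -/
lemma linearTuranNumber_eq_of_covering {α β : Type*} [Fintype α] [DecidableEq α]
    {T : Finset (Finset α)} {F : Set (Hypergraph β)}
    (hT : IsTripleSystem T) (hL : IsPartialLinear T)
    (hcov : ∀ a b : α, a ≠ b → ∃ e ∈ T, a ∈ e ∧ b ∈ e) (hF : (ofFinsets T).IsFree F) :
    (linearTuranNumber 3 (Fintype.card α) F : ℝ) =
      (Fintype.card α : ℝ) * ((Fintype.card α : ℝ) - 1) / 6 := by
  have h := six_mul_card_add_card_eq hT hL hcov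
  have h1 : linearTuranNumber 3 (Fintype.card α) F = T.card := by
    refine le_antisymm (linearTuranNumber_le fun T' hT' hL' _ => ?_)
      (card_le_linearTuranNumber hT hL hF)
    have := six_mul_card_add_card_le hT' hL'
    rw [Fintype.card_fin] at this
    omega
  rw [h1]
  have h2 : (6 * T.card + Fintype.card α : ℝ) = Fintype.card α * Fintype.card α := by
    exact_mod_cast h
  linarith

variable (V : Type*) [AddCommGroup V] [Fintype V] [DecidableEq V]

/-- The triples of distinct elements of `V` with sum zero; the lines of the affine space when `V`
is a vector space over `𝔽₃`. -/
def zeroSumTriples : Finset (Finset V) :=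
  Finset.univ.filter fun e => e.card = 3 ∧ ∑ x ∈ e, x = 0

/-- The triples of distinct nonzero elements of `V` with sum zero; the lines of the projective
space when `V` is a vector space over `𝔽₂`. -/
def nonzeroZeroSumTriples : Finset (Finset {x : V // x ≠ 0}) :=
  Finset.univ.filter fun e => e.card = 3 ∧ ∑ x ∈ e, (x : V) = 0

variable {V}

lemma triple_mem_zeroSumTriples {a b c : V} (hab : a ≠ b) (hac : a ≠ c) (hbc : b ≠ c) :
    {a, b, c} ∈ zeroSumTriples V ↔ a + b + c = 0 := by
  simp [zeroSumTriples, hab, hac, hbc, add_assoc]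

lemma triple_mem_nonzeroZeroSumTriples {a b c : {x : V // x ≠ 0}} (hab : a ≠ b) (hac : a ≠ c)
    (hbc : b ≠ c) : {a, b, c} ∈ nonzeroZeroSumTriples V ↔ (a + b + c : V) = 0 := by
  simp [nonzeroZeroSumTriples, hab, hac, hbc, add_assoc]

lemma isTripleSystem_zeroSumTriples : IsTripleSystem (zeroSumTriples V) := fun e he => by
  simp only [zeroSumTriples, Finset.mem_filter] at he
  exact he.2.1

lemma isTripleSystem_nonzeroZeroSumTriples : IsTripleSystem (nonzeroZeroSumTriples V) :=
  fun e he => by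
    simp only [nonzeroZeroSumTriples, Finset.mem_filter] at he
    exact he.2.1

lemma isPartialLinear_zeroSumTriples : IsPartialLinear (zeroSumTriples V) := by
  intro e he f hf a b hab hae hbe haf hbf
  obtain ⟨c, hac, hbc, rfl⟩ :=
    exists_eq_triple_of_mem (isTripleSystem_zeroSumTriples e he) hab hae hbe
  obtain ⟨d, had, hbd, rfl⟩ :=
    exists_eq_triple_of_mem (isTripleSystem_zeroSumTriples f hf) hab haf hbf
  rw [triple_mem_zeroSumTriples hab hac hbc] at he
  rw [triple_mem_zeroSumTriples hab had hbd] at hf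
  rw [add_left_cancel (he.trans hf.symm)]

lemma isPartialLinear_nonzeroZeroSumTriples : IsPartialLinear (nonzeroZeroSumTriples V) := by
  intro e he f hf a b hab hae hbe haf hbf
  obtain ⟨c, hac, hbc, rfl⟩ :=
    exists_eq_triple_of_mem (isTripleSystem_nonzeroZeroSumTriples e he) hab hae hbe
  obtain ⟨d, had, hbd, rfl⟩ :=
    exists_eq_triple_of_mem (isTripleSystem_nonzeroZeroSumTriples f hf) hab haf hbf
  rw [triple_mem_nonzeroZeroSumTriples hab hac hbc] at he
  rw [triple_mem_nonzeroZeroSumTriples hab had hbd] at hf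
  rw [Subtype.ext (add_left_cancel (he.trans hf.symm))]

/-- The third point is -(a + b). Were it equal to a or b, exponent 3 would force a = b. -/
lemma zeroSumTriples_covers (h3 : ∀ x : V, 3 • x = 0) (a b : V) (hab : a ≠ b) :
    ∃ e ∈ zeroSumTriples V, a ∈ e ∧ b ∈ e := by
  have hac : a ≠ -(a + b) := by
    intro h
    apply hab
    have h3a := h3 a
    have h4 : a + a + b = 0 := by nth_rw 1 [h]; abel
    have h5 : a - b = 3 • a - (a + a + b) := by abel
    rw [h3a, h4, sub_zero] at h5
    exact sub_eq_zero.1 h5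
  have hbc : b ≠ -(a + b) := by
    intro h
    apply hab
    have h4 : a + b + b = 0 := by nth_rw 2 [h]; abel
    have h5 : a - b = (a + b + b) - 3 • b := by abel
    rw [h3 b, h4, sub_zero] at h5
    exact sub_eq_zero.1 h5
  refine ⟨{a, b, -(a + b)}, (triple_mem_zeroSumTriples hab hac hbc).2 (by abel), ?_, ?_⟩ <;> simp

lemma nonzeroZeroSumTriples_covers (h2 : ∀ x : V, x + x = 0) (a b : {x : V // x ≠ 0})
    (hab : a ≠ b) : ∃ e ∈ nonzeroZeroSumTriples V, a ∈ e ∧ b ∈ e := by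
  have hc : (a + b : V) ≠ 0 := by
    intro h
    apply hab
    have h5 : (a : V) - b = (a + b) - (b + b) := by abel
    rw [h, h2, sub_zero] at h5
    exact Subtype.ext (sub_eq_zero.1 h5)
  have hac : a ≠ ⟨a + b, hc⟩ := fun h => b.2 (left_eq_add.1 (congrArg Subtype.val h))
  have hbc : b ≠ ⟨a + b, hc⟩ := fun h => a.2 (right_eq_add.1 (congrArg Subtype.val h))
  refine ⟨{a, b, ⟨a + b, hc⟩}, (triple_mem_nonzeroZeroSumTriples hab hac hbc).2 (h2 _), ?_, ?_⟩ <;>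
    simp

lemma not_hasPasch_zeroSumTriples (h2 : ∀ x : V, x + x = 0 → x = 0) :
    ¬ HasPasch (zeroSumTriples V) := by
  rintro ⟨a, b, c, d, e, f, hnd, h1, h3, h4, h5⟩
  simp only [List.nodup_cons, List.mem_cons, List.not_mem_nil, or_false, not_or] at hnd
  obtain ⟨⟨hab, hac, had, hae, haf⟩, ⟨hbc, hbd, hbe, hbf⟩, ⟨hcd, hce, hcf⟩, ⟨hde, hdf⟩, hef, -⟩ := hnd
  rw [triple_mem_zeroSumTriples (by assumption) (by assumption) (by assumption)] at h1 h3 h4 h5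
  -- In this signed sum of the four triples a, b, d, e cancel, while c and f survive with
  -- coefficients 2 and -2.
  have h : (c - f) + (c - f) = (a + b + c) + (c + d + e) - (a + e + f) - (b + d + f) := by abel
  rw [h1, h3, h4, h5] at h
  simp only [add_zero, sub_zero] at h
  exact hcf (sub_eq_zero.1 (h2 _ h))

lemma not_hasConfig14_nonzeroZeroSumTriples (h2 : ∀ x : V, x + x = 0) :
    ¬ HasConfig14 (nonzeroZeroSumTriples V) := by
  rintro ⟨a, b, c, d, e, f, g, hnd, h1, h3, h4, h5⟩
  simp only [List.nodup_cons, List.mem_cons, List.not_mem_nil, or_false, not_or] at hnd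
  obtain ⟨⟨hab, hac, had, hae, haf, hag⟩, ⟨hbc, hbd, hbe, hbf, hbg⟩, ⟨hcd, hce, hcf, hcg⟩,
    ⟨hde, hdf, hdg⟩, ⟨hef, heg⟩, hfg, -⟩ := hnd
  rw [triple_mem_nonzeroZeroSumTriples (by assumption) (by assumption) (by assumption)]
    at h1 h3 h4 h5
  -- Modulo doubled points, the sum of the four triples leaves only d and g, the two points lying in
  -- a single triple.
  have h : (d - g : V) = (c + d + e) + (a + b + c) + (a + e + f) - (b + f + g)
      - (a + a) - (c + c) - (e + e) := by abel
  rw [h1, h3, h4, h5, h2 a, h2 c, h2 e] at h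
  simp only [add_zero, sub_zero] at h
  exact hdg (Subtype.ext (sub_eq_zero.1 h))

end Steiner

/-! ### Transversal designs of abelian groups -/

section Transversal

variable (G : Type*) [AddCommGroup G] [Fintype G] [DecidableEq G]

/-- The transversal design of the Latin square `x + y + z = 0` over `G`. -/
def transversalTriples : Finset (Finset (Fin 3 × G)) :=
  Finset.univ.filter fun e => e.card = 3 ∧ Set.InjOn Prod.fst (e : Set (Fin 3 × G)) ∧
    ∑ x ∈ e, x.2 = 0

variable {G}

lemma triple_mem_transversalTriples {a b c : Fin 3 × G} (hab : a ≠ b) (hac : a ≠ c) (hbc : b ≠ c) :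
    {a, b, c} ∈ transversalTriples G ↔
      a.1 ≠ b.1 ∧ a.1 ≠ c.1 ∧ b.1 ≠ c.1 ∧ a.2 + b.2 + c.2 = 0 := by
  have h1 : ({a, b, c} : Finset (Fin 3 × G)).card = 3 := Finset.card_eq_three.2
    ⟨a, b, c, hab, hac, hbc, rfl⟩
  have h2 : ∑ x ∈ ({a, b, c} : Finset (Fin 3 × G)), x.2 = a.2 + b.2 + c.2 := by
    simp [hab, hac, hbc, add_assoc]
  simp only [transversalTriples, Finset.mem_filter, Finset.mem_univ, true_and, h1, h2]
  rw [← and_assoc, ← and_assoc, and_assoc (a := a.1 ≠ b.1)]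
  refine and_congr_left fun _ => ⟨fun h => ⟨?_, ?_, ?_⟩, ?_⟩
  · exact fun h' => hab (h (by simp) (by simp) h')
  · exact fun h' => hac (h (by simp) (by simp) h')
  · exact fun h' => hbc (h (by simp) (by simp) h')
  · rintro ⟨h3, h4, h5⟩ x hx y hy hxy
    simp only [Finset.coe_insert, Finset.coe_singleton, Set.mem_insert_iff,
      Set.mem_singleton_iff] at hx hy
    rcases hx with rfl | rfl | rfl <;> rcases hy with rfl | rfl | rfl <;>
      first
      | rfl
      | exact absurd hxy (by assumption)
      | exact absurd hxy.symm (by assumption)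

lemma isTripleSystem_transversalTriples : IsTripleSystem (transversalTriples G) := fun e he => by
  simp only [transversalTriples, Finset.mem_filter] at he
  exact he.2.1

lemma eq_of_ne_of_ne {i j k l : Fin 3} (hij : i ≠ j) (hik : i ≠ k) (hjk : j ≠ k) (hil : i ≠ l)
    (hjl : j ≠ l) : k = l := by omega

lemma isPartialLinear_transversalTriples : IsPartialLinear (transversalTriples G) := by
  intro e he f hf a b hab hae hbe haf hbf
  obtain ⟨c, hac, hbc, rfl⟩ :=
    exists_eq_triple_of_mem (isTripleSystem_transversalTriples e he) hab hae hbe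
  obtain ⟨d, had, hbd, rfl⟩ :=
    exists_eq_triple_of_mem (isTripleSystem_transversalTriples f hf) hab haf hbf
  rw [triple_mem_transversalTriples hab hac hbc] at he
  rw [triple_mem_transversalTriples hab had hbd] at hf
  have h : c = d := Prod.ext (eq_of_ne_of_ne he.1 he.2.1 he.2.2.1 hf.2.1 hf.2.2.1)
    (add_left_cancel (he.2.2.2.trans hf.2.2.2.symm))
  rw [h]

/-- The first two coordinates determine the third. The lower bound is enough, since
`nine_mul_card_le` supplies the matching upper one. -/
lemma card_transversalTriples : Fintype.card G * Fintype.card G ≤ (transversalTriples G).card := by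
  rw [← Fintype.card_prod, ← Finset.card_univ]
  refine Finset.card_le_card_of_injOn
    (fun p : G × G => {((0 : Fin 3), p.1), (1, p.2), (2, -(p.1 + p.2))}) ?_ ?_
  · intro p _
    refine (triple_mem_transversalTriples (by simp) (by simp) (by simp)).2 ?_
    simp
  · rintro ⟨a, b⟩ - ⟨c, d⟩ - h
    have h1 : ((0 : Fin 3), a) ∈ ({(0, c), (1, d), (2, -(c + d))} : Finset (Fin 3 × G)) := by
      simp only [← h]; simp
    have h2 : ((1 : Fin 3), b) ∈ ({(0, c), (1, d), (2, -(c + d))} : Finset (Fin 3 × G)) := by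
      simp only [← h]; simp
    simp at h1 h2
    rw [h1, h2]

/-- The crossing triple a, e, f uses all three classes, yet each of its points shares a triple with
the centre c, which leaves no class for c. -/
lemma not_hasFan3_transversalTriples : ¬ HasFan3 (transversalTriples G) := by
  rintro ⟨a, b, c, d, e, f, g, hnd, h1, h3, h4, h5⟩
  simp only [List.nodup_cons, List.mem_cons, List.not_mem_nil, or_false, not_or] at hnd
  obtain ⟨⟨hab, hac, had, hae, haf, hag⟩, ⟨hbc, hbd, hbe, hbf, hbg⟩, ⟨hcd, hce, hcf, hcg⟩,
    ⟨hde, hdf, hdg⟩, ⟨hef, heg⟩, hfg, -⟩ := hnd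
  rw [triple_mem_transversalTriples (by assumption) (by assumption) (by assumption)]
    at h1 h3 h4 h5
  omega

lemma not_hasPasch_transversalTriples (h2 : ∀ x : G, x + x = 0 → x = 0) :
    ¬ HasPasch (transversalTriples G) := by
  rintro ⟨a, b, c, d, e, f, hnd, h1, h3, h4, h5⟩
  simp only [List.nodup_cons, List.mem_cons, List.not_mem_nil, or_false, not_or] at hnd
  obtain ⟨⟨hab, hac, had, hae, haf⟩, ⟨hbc, hbd, hbe, hbf⟩, ⟨hcd, hce, hcf⟩, ⟨hde, hdf⟩, hef, -⟩ := hnd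
  rw [triple_mem_transversalTriples (by assumption) (by assumption) (by assumption)]
    at h1 h3 h4 h5
  have h : (c.2 - f.2) + (c.2 - f.2) = (a.2 + b.2 + c.2) + (c.2 + d.2 + e.2)
    - (a.2 + e.2 + f.2) - (b.2 + d.2 + f.2) := by abel
  rw [h1.2.2.2, h3.2.2.2, h4.2.2.2, h5.2.2.2] at h
  simp only [add_zero, sub_zero] at h
  -- c and f lie in the same class, since each shares triples with both a and e.
  exact hcf (Prod.ext (by omega) (sub_eq_zero.1 (h2 _ h)))

lemma not_hasConfig14_transversalTriples (h2 : ∀ x : G, x + x = 0) :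
    ¬ HasConfig14 (transversalTriples G) := by
  rintro ⟨a, b, c, d, e, f, g, hnd, h1, h3, h4, h5⟩
  simp only [List.nodup_cons, List.mem_cons, List.not_mem_nil, or_false, not_or] at hnd
  obtain ⟨⟨hab, hac, had, hae, haf, hag⟩, ⟨hbc, hbd, hbe, hbf, hbg⟩, ⟨hcd, hce, hcf, hcg⟩,
    ⟨hde, hdf, hdg⟩, ⟨hef, heg⟩, hfg, -⟩ := hnd
  rw [triple_mem_transversalTriples (by assumption) (by assumption) (by assumption)]
    at h1 h3 h4 h5
  have h : d.2 - g.2 = (c.2 + d.2 + e.2) + (a.2 + b.2 + c.2) + (a.2 + e.2 + f.2)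
      - (b.2 + f.2 + g.2) - (a.2 + a.2) - (c.2 + c.2) - (e.2 + e.2) := by abel
  rw [h1.2.2.2, h3.2.2.2, h4.2.2.2, h5.2.2.2, h2 a.2, h2 c.2, h2 e.2] at h
  simp only [add_zero, sub_zero] at h
  exact hdg (Prod.ext (by omega) (sub_eq_zero.1 h))

end Transversal

/-! ### The bound n²/9 for fan-free linear systems -/

section FanUpperBound

variable {α : Type*} [DecidableEq α] {T : Finset (Finset α)}

/-- In a fan-free linear triple system no point outside a triple is joined to all its points. -/
lemma hasFan3_of_joined (hT : IsTripleSystem T) (hL : IsPartialLinear T) {a b c v : α}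
    (hab : a ≠ b) (hac : a ≠ c) (hbc : b ≠ c) (he : {a, b, c} ∈ T)
    (hv : v ∉ ({a, b, c} : Finset α)) {ea eb ec : Finset α} (ha : ea ∈ T) (hb : eb ∈ T)
    (hc : ec ∈ T) (haa : a ∈ ea) (hbb : b ∈ eb) (hcc : c ∈ ec) (hva : v ∈ ea) (hvb : v ∈ eb)
    (hvc : v ∈ ec) : HasFan3 T := by
  have hva' : v ≠ a := by rintro rfl; simp at hv
  have hvb' : v ≠ b := by rintro rfl; simp at hv
  have hvc' : v ≠ c := by rintro rfl; simp at hv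
  obtain ⟨p, hap, hvp, rfl⟩ := exists_eq_triple_of_mem (hT _ ha) hva'.symm haa hva
  obtain ⟨q, hvq, hbq, rfl⟩ := exists_eq_triple_of_mem (hT _ hb) hvb' hvb hbb
  obtain ⟨r, hvr, hcr, rfl⟩ := exists_eq_triple_of_mem (hT _ hc) hvc' hvc hcc
  -- By linearity a triple with two points in {a, b, c} is {a, b, c} itself, so it misses v. This
  -- keeps p, q, r off the triple.
  have key : ∀ e ∈ T, ∀ x y, x ≠ y → x ∈ e → y ∈ e → x ∈ ({a, b, c} : Finset α) →
      y ∈ ({a, b, c} : Finset α) → v ∉ e := by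
    intro e hee x y hxy hx hy hx' hy' hve
    rw [hL e hee _ he x y hxy hx hy hx' hy'] at hve
    exact hv hve
  have hpb : p ≠ b := by rintro rfl; exact key _ ha a p hab (by simp) (by simp) (by simp) (by simp) hva
  have hpc : p ≠ c := by rintro rfl; exact key _ ha a p hac (by simp) (by simp) (by simp) (by simp) hva
  have hqa : q ≠ a := by rintro rfl; exact key _ hb q b hab (by simp) (by simp) (by simp) (by simp) hvb
  have hqc : q ≠ c := by rintro rfl; exact key _ hb b q hbc (by simp) (by simp) (by simp) (by simp) hvb
  have hra : r ≠ a := by rintro rfl; exact key _ hc r c hac (by simp) (by simp) (by simp) (by simp) hvc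
  have hrb : r ≠ b := by rintro rfl; exact key _ hc r c hbc (by simp) (by simp) (by simp) (by simp) hvc
  have hpq : p ≠ q := by
    rintro rfl
    have := hL _ ha _ hb v p hvp (by simp) (by simp) (by simp) (by simp)
    have h : b ∈ ({a, v, p} : Finset α) := by rw [this]; simp
    simp [hab.symm, hvb'.symm, hbq] at h
  have hpr : p ≠ r := by
    rintro rfl
    have := hL _ ha _ hc v p hvp (by simp) (by simp) (by simp) (by simp)
    have h : c ∈ ({a, v, p} : Finset α) := by rw [this]; simp
    simp [hac.symm, hvc'.symm, hcr] at h
  have hqr : q ≠ r := by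
    rintro rfl
    have := hL _ hb _ hc v q hvq (by simp) (by simp) (by simp) (by simp)
    have h : c ∈ ({v, b, q} : Finset α) := by rw [this]; simp
    simp [hbc.symm, hvc'.symm, hcr] at h
  -- The joined point v is the centre of the fan, and {a, b, c} is its crossing triple.
  refine ⟨a, p, v, q, b, c, r, ?_, ?_, ?_, he, hc⟩
  · simp only [List.nodup_cons, List.mem_cons, List.not_mem_nil, or_false, not_or,
      List.nodup_nil, not_false_eq_true, and_true]
    refine ⟨⟨?_, ?_, ?_, ?_, ?_, ?_⟩, ⟨?_, ?_, ?_, ?_, ?_⟩, ⟨?_, ?_, ?_, ?_⟩, ⟨?_, ?_, ?_⟩,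
      ⟨?_, ?_⟩, ?_⟩ <;> first | assumption | (refine Ne.symm ?_; assumption)
  · rwa [Finset.pair_comm p v]
  · have : ({v, q, b} : Finset α) = {v, b, q} := by rw [Finset.pair_comm q b]
    rwa [this]

variable [Fintype α]

/-- The points outside `e` joined to `x` by a triple come in pairs, one for every triple through
`x` other than `e`. -/
lemma two_mul_degree_eq (hT : IsTripleSystem T) (hL : IsPartialLinear T)
    {e : Finset α} (he : e ∈ T) {x : α} (hx : x ∈ e) :
    2 * (T.filter (x ∈ ·)).card =
      (Finset.univ.filter fun v => v ∉ e ∧ ∃ f ∈ T, x ∈ f ∧ v ∈ f).card + 2 := by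
  have h1 : (Finset.univ.filter fun v => v ∉ e ∧ ∃ f ∈ T, x ∈ f ∧ v ∈ f) =
      ((T.filter (x ∈ ·)).erase e).biUnion fun f => f.erase x := by
    ext v
    simp only [Finset.mem_filter, Finset.mem_univ, true_and, Finset.mem_biUnion, Finset.mem_erase]
    constructor
    · rintro ⟨hv, f, hf, hxf, hvf⟩
      exact ⟨f, ⟨fun h => hv (h ▸ hvf), hf, hxf⟩, fun h => hv (h ▸ hx), hvf⟩
    · rintro ⟨f, ⟨hfe, hf, hxf⟩, hvx, hvf⟩
      exact ⟨fun hv => hfe (hL f hf e he v x hvx hvf hxf hv hx), f, hf, hxf, hvf⟩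
  have hmem : e ∈ T.filter (x ∈ ·) := Finset.mem_filter.2 ⟨he, hx⟩
  rw [h1, Finset.card_biUnion, Finset.sum_congr rfl (g := fun _ => 2), Finset.sum_const,
    Finset.card_erase_of_mem hmem, smul_eq_mul]
  · have := Finset.card_pos.2 ⟨e, hmem⟩
    omega
  · intro f hf
    simp only [Finset.mem_erase, Finset.mem_filter] at hf
    rw [Finset.card_erase_of_mem hf.2.2, hT f hf.2.1]
  · intro f hf g hg hfg
    simp only [Finset.mem_coe, Finset.mem_erase, Finset.mem_filter] at hf hg
    refine Finset.disjoint_left.2 fun v hvf hvg => ?_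
    simp only [Finset.mem_erase] at hvf hvg
    exact hfg (hL f hf.2.1 g hg.2.1 v x hvf.1 hvf.2 hf.2.2 hvg.2 hg.2.2)

/-- The degree sum along a triple of a fan-free linear triple system is at most the number of
points. -/
lemma sum_degree_le (hT : IsTripleSystem T) (hL : IsPartialLinear T) (hF : ¬ HasFan3 T)
    {e : Finset α} (he : e ∈ T) :
    ∑ x ∈ e, (T.filter (x ∈ ·)).card ≤ Fintype.card α := by
  obtain ⟨a, b, c, hab, hac, hbc, rfl⟩ := Finset.card_eq_three.1 (hT e he)
  have ha := two_mul_degree_eq hT hL he (x := a) (by simp)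
  have hb := two_mul_degree_eq hT hL he (x := b) (by simp)
  have hc := two_mul_degree_eq hT hL he (x := c) (by simp)
  rw [Finset.sum_insert (by simp [hab, hac]), Finset.sum_insert (by simp [hbc]),
    Finset.sum_singleton]
  set A := Finset.univ.filter fun v => v ∉ ({a, b, c} : Finset α) ∧ ∃ f ∈ T, a ∈ f ∧ v ∈ f with hA
  set B := Finset.univ.filter fun v => v ∉ ({a, b, c} : Finset α) ∧ ∃ f ∈ T, b ∈ f ∧ v ∈ f with hB
  set C := Finset.univ.filter fun v => v ∉ ({a, b, c} : Finset α) ∧ ∃ f ∈ T, c ∈ f ∧ v ∈ f with hC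
  have hU : ({a, b, c} : Finset α)ᶜ.card + 3 = Fintype.card α := by
    rw [← hT _ he, Finset.card_compl_add_card]
  have h1 : (A ∪ B).card ≤ ({a, b, c} : Finset α)ᶜ.card := by
    refine Finset.card_le_card fun v hv => Finset.mem_compl.2 ?_
    rcases Finset.mem_union.1 hv with hv | hv
    · exact (Finset.mem_filter.1 hv).2.1
    · exact (Finset.mem_filter.1 hv).2.1
  have h2 : (A ∩ B).card + C.card ≤ ({a, b, c} : Finset α)ᶜ.card := by
    -- A point in all three of A, B, C would give a fan, so |A| + |B| + |C| = |A ∪ B| + |A ∩ B| +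
    -- |C| ≤ 2(n - 3).
    rw [← Finset.card_union_of_disjoint]
    · refine Finset.card_le_card fun v hv => Finset.mem_compl.2 ?_
      rcases Finset.mem_union.1 hv with hv | hv
      · exact (Finset.mem_filter.1 (Finset.mem_inter.1 hv).1).2.1
      · exact (Finset.mem_filter.1 hv).2.1
    · refine Finset.disjoint_left.2 fun v hv hvc => hF ?_
      obtain ⟨hva, hvb⟩ := Finset.mem_inter.1 hv
      obtain ⟨-, hv, ea, hea, ha1, ha2⟩ := Finset.mem_filter.1 hva
      obtain ⟨-, -, eb, heb, hb1, hb2⟩ := Finset.mem_filter.1 hvb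
      obtain ⟨-, -, ec, hec, hc1, hc2⟩ := Finset.mem_filter.1 hvc
      exact hasFan3_of_joined hT hL hab hac hbc he hv hea heb hec ha1 hb1 hc1 ha2 hb2 hc2
  have h3 := Finset.card_union_add_card_inter A B
  omega

/-- A fan-free linear triple system on `n` points has at most `n² / 9` triples. -/
lemma nine_mul_card_le (hT : IsTripleSystem T) (hL : IsPartialLinear T) (hF : ¬ HasFan3 T) :
    9 * T.card ≤ Fintype.card α ^ 2 := by
  have hswap : ∀ g : α → ℕ, ∑ e ∈ T, ∑ x ∈ e, g x = ∑ x, (T.filter (x ∈ ·)).card * g x := by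
    intro g
    rw [Finset.sum_comm' (t' := Finset.univ) (s' := fun x => T.filter (x ∈ ·))]
    · simp
    · simp
  have h1 : ∑ x : α, (T.filter (x ∈ ·)).card = 3 * T.card := by
    have := hswap fun _ => 1
    simp only [mul_one] at this
    rw [← this, Finset.sum_congr rfl (g := fun _ => 3), Finset.sum_const, smul_eq_mul, mul_comm]
    intro e he
    rw [Finset.sum_const, hT e he, smul_eq_mul]
  have h2 : ∑ x : α, (T.filter (x ∈ ·)).card ^ 2 ≤ T.card * Fintype.card α := by
    simp only [sq]
    rw [← hswap, ← smul_eq_mul]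
    exact Finset.sum_le_card_nsmul _ _ _ fun e he => sum_degree_le hT hL hF he
  -- Cauchy–Schwarz: (3|T|)² ≤ n ∑ d(x)² ≤ n²|T|, after which |T| is cancelled.
  have h3 := sq_sum_le_card_mul_sum_sq (s := Finset.univ) (f := fun x : α => (T.filter (x ∈ ·)).card)
  rw [h1, Finset.card_univ] at h3
  rcases Nat.eq_zero_or_pos T.card with h0 | h0
  · omega
  · refine Nat.le_of_mul_le_mul_left ?_ h0
    calc T.card * (9 * T.card) = (3 * T.card) ^ 2 := by ring
      _ ≤ Fintype.card α * (T.card * Fintype.card α) := h3.trans (Nat.mul_le_mul_left _ h2)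
      _ = T.card * Fintype.card α ^ 2 := by ring

end FanUpperBound

/-! ### Linearising systems without four triples on seven points -/

section FourOnSeven

variable {α : Type*} [DecidableEq α] {T : Finset (Finset α)}

lemma HasFourOnSeven.of_subset {e₁ e₂ e₃ e₄ U : Finset α} (h : [e₁, e₂, e₃, e₄].Nodup)
    (h₁ : e₁ ∈ T) (h₂ : e₂ ∈ T) (h₃ : e₃ ∈ T) (h₄ : e₄ ∈ T) (s₁ : e₁ ⊆ U) (s₂ : e₂ ⊆ U)
    (s₃ : e₃ ⊆ U) (s₄ : e₄ ⊆ U) (hU : U.card ≤ 7) : HasFourOnSeven T := by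
  refine ⟨[e₁, e₂, e₃, e₄].toFinset, ?_, List.toFinset_card_of_nodup h, ?_⟩
  · intro e he
    simp only [List.mem_toFinset, List.mem_cons, List.not_mem_nil, or_false] at he
    rcases he with rfl | rfl | rfl | rfl <;> assumption
  · refine (Finset.card_le_card (Finset.biUnion_subset.2 fun e he => ?_)).trans hU
    simp only [List.mem_toFinset, List.mem_cons, List.not_mem_nil, or_false] at he
    rcases he with rfl | rfl | rfl | rfl <;> assumption

lemma HasPasch.hasFourOnSeven (h : HasPasch T) : HasFourOnSeven T := by
  obtain ⟨a, b, c, d, e, f, hnd, h1, h2, h3, h4⟩ := h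
  refine .of_subset (U := [a, b, c, d, e, f].toFinset) ?_ h1 h2 h3 h4 ?_ ?_ ?_ ?_
    ((List.toFinset_card_le _).trans (by simp))
  · simp only [List.nodup_cons, List.mem_cons, List.not_mem_nil, or_false, not_or] at hnd ⊢
    obtain ⟨⟨hab, hac, had, hae, haf⟩, ⟨hbc, hbd, hbe, hbf⟩, ⟨hcd, hce, hcf⟩, ⟨hde, hdf⟩, hef, -⟩ := hnd
    have key : ∀ {x : α} {s t : Finset α}, x ∈ s → x ∉ t → ¬ s = t := fun h1 h2 h => h2 (h ▸ h1)
    refine ⟨⟨key (x := a) ?_ ?_, key (x := b) ?_ ?_, key (x := a) ?_ ?_⟩,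
      ⟨key (x := c) ?_ ?_, key (x := c) ?_ ?_⟩, key (x := a) ?_ ?_, by simp⟩ <;>
      simp only [Finset.mem_insert, Finset.mem_singleton] <;> tauto
  all_goals intro x hx; simp at hx ⊢; tauto

lemma HasConfig14.hasFourOnSeven (h : HasConfig14 T) : HasFourOnSeven T := by
  obtain ⟨a, b, c, d, e, f, g, hnd, h1, h2, h3, h4⟩ := h
  refine .of_subset (U := [a, b, c, d, e, f, g].toFinset) ?_ h1 h2 h3 h4 ?_ ?_ ?_ ?_
    ((List.toFinset_card_le _).trans (by simp))
  · simp only [List.nodup_cons, List.mem_cons, List.not_mem_nil, or_false, not_or] at hnd ⊢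
    obtain ⟨⟨hab, hac, had, hae, haf, hag⟩, ⟨hbc, hbd, hbe, hbf, hbg⟩, ⟨hcd, hce, hcf, hcg⟩,
      ⟨hde, hdf, hdg⟩, ⟨hef, heg⟩, hfg, -⟩ := hnd
    have key : ∀ {x : α} {s t : Finset α}, x ∈ s → x ∉ t → ¬ s = t := fun h1 h2 h => h2 (h ▸ h1)
    refine ⟨⟨key (x := a) ?_ ?_, key (x := b) ?_ ?_, key (x := a) ?_ ?_⟩,
      ⟨key (x := c) ?_ ?_, key (x := c) ?_ ?_⟩, key (x := a) ?_ ?_, by simp⟩ <;>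
      simp only [Finset.mem_insert, Finset.mem_singleton] <;> tauto
  all_goals intro x hx; simp at hx ⊢; tauto

lemma HasFan3.hasFourOnSeven (h : HasFan3 T) : HasFourOnSeven T := by
  obtain ⟨a, b, c, d, e, f, g, hnd, h1, h2, h3, h4⟩ := h
  refine .of_subset (U := [a, b, c, d, e, f, g].toFinset) ?_ h1 h2 h3 h4 ?_ ?_ ?_ ?_
    ((List.toFinset_card_le _).trans (by simp))
  · simp only [List.nodup_cons, List.mem_cons, List.not_mem_nil, or_false, not_or] at hnd ⊢
    obtain ⟨⟨hab, hac, had, hae, haf, hag⟩, ⟨hbc, hbd, hbe, hbf, hbg⟩, ⟨hcd, hce, hcf, hcg⟩,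
      ⟨hde, hdf, hdg⟩, ⟨hef, heg⟩, hfg, -⟩ := hnd
    have key : ∀ {x : α} {s t : Finset α}, x ∈ s → x ∉ t → ¬ s = t := fun h1 h2 h => h2 (h ▸ h1)
    refine ⟨⟨key (x := a) ?_ ?_, key (x := b) ?_ ?_, key (x := a) ?_ ?_⟩,
      ⟨key (x := c) ?_ ?_, key (x := d) ?_ ?_⟩, key (x := a) ?_ ?_, by simp⟩ <;>
      simp only [Finset.mem_insert, Finset.mem_singleton] <;> tauto
  all_goals intro x hx; simp at hx ⊢; tauto

lemma HasFourOnSeven.mono {S : Finset (Finset α)} (hST : S ⊆ T) (h : HasFourOnSeven S) :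
    HasFourOnSeven T := by
  obtain ⟨R, hR, h⟩ := h
  exact ⟨R, hR.trans hST, h⟩

/-- A member of `T` outside a maximal linear subsystem shares two points with one of its
members. -/
lemma exists_maximal_partialLinear (T : Finset (Finset α)) : ∃ L ⊆ T, IsPartialLinear L ∧
    ∀ e ∈ T \ L, ∃ f ∈ L, 2 ≤ (f ∩ e).card := by
  classical
  obtain ⟨L, hL, hmax⟩ := Finset.exists_max_image (T.powerset.filter IsPartialLinear) Finset.card
    ⟨∅, Finset.mem_filter.2 ⟨Finset.empty_mem_powerset T, fun e he => absurd he (by simp)⟩⟩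
  rw [Finset.mem_filter, Finset.mem_powerset] at hL
  refine ⟨L, hL.1, hL.2, fun e he => ?_⟩
  rw [Finset.mem_sdiff] at he
  by_contra! hcon
  have key : ∀ f ∈ L, ∀ a b, a ≠ b → a ∈ e → b ∈ e → a ∈ f → b ∈ f → False := by
    intro f hf a b hab hae hbe haf hbf
    have h1 : 1 < (f ∩ e).card := Finset.one_lt_card.2
      ⟨a, Finset.mem_inter.2 ⟨haf, hae⟩, b, Finset.mem_inter.2 ⟨hbf, hbe⟩, hab⟩
    exact absurd (hcon f hf) (by omega)
  have h1 : IsPartialLinear (insert e L) := by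
    intro s hs t ht a b hab has hbs hat hbt
    rcases Finset.mem_insert.1 hs with rfl | hs' <;> rcases Finset.mem_insert.1 ht with rfl | ht'
    · rfl
    · exact (key t ht' a b hab has hbs hat hbt).elim
    · exact (key s hs' a b hab hat hbt has hbs).elim
    · exact hL.2 s hs' t ht' a b hab has hbs hat hbt
  have h2 := hmax (insert e L) (Finset.mem_filter.2
    ⟨Finset.mem_powerset.2 (Finset.insert_subset he.1 hL.1), h1⟩)
  rw [Finset.card_insert_of_notMem he.2] at h2
  omega

/-- A triple system on `n` points without four triples on seven points becomes linear after
deleting at most `n / 2` triples. -/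
lemma exists_partialLinear_subset [Fintype α] (hT : IsTripleSystem T) (h : ¬ HasFourOnSeven T) :
    ∃ L ⊆ T, IsPartialLinear L ∧ T.card ≤ L.card + Fintype.card α / 2 := by
  obtain ⟨L, hLT, hL, hconf⟩ := exists_maximal_partialLinear T
  refine ⟨L, hLT, hL, ?_⟩
  choose! g hgL hg using hconf
  -- The chosen partner `g e` in L shares two points with e, so together they span at most four.
  have hunion : ∀ e ∈ T \ L, (g e ∪ e).card ≤ 4 := by
    intro e he
    have h1 := Finset.card_union_add_card_inter (g e) e
    rw [hT _ (hLT (hgL e he)), hT e (Finset.mem_sdiff.1 he).1] at h1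
    have := hg e he
    omega
  have hne : ∀ e ∈ T \ L, g e ≠ e := fun e he hge =>
    (Finset.mem_sdiff.1 he).2 (hge ▸ hgL e he)
  -- At most two deleted triples share a partner f: three of them would span, with f, at most 4 + 1
  -- + 1 = 6 points.
  have hfib : (T \ L).card ≤ 2 * ((T \ L).image g).card := by
    refine Finset.card_le_mul_card_image _ 2 fun f hf => ?_
    by_contra! hcard
    obtain ⟨e₁, e₂, e₃, h1, h2, h3, h12, h13, h23⟩ := Finset.two_lt_card_iff.1 hcard
    rw [Finset.mem_filter] at h1 h2 h3
    obtain ⟨h1, rfl⟩ := h1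
    obtain ⟨h2, hg2⟩ := h2
    obtain ⟨h3, hg3⟩ := h3
    have n2 := hne e₂ h2
    have n3 := hne e₃ h3
    rw [hg2] at n2
    rw [hg3] at n3
    have c2 := hg e₂ h2
    have c3 := hg e₃ h3
    rw [hg2] at c2
    rw [hg3] at c3
    refine h (.of_subset (e₁ := g e₁) (e₂ := e₁) (e₃ := e₂) (e₄ := e₃)
      (U := g e₁ ∪ e₁ ∪ (e₂ \ g e₁) ∪ (e₃ \ g e₁)) ?_ (hLT (hgL e₁ h1)) (Finset.mem_sdiff.1 h1).1
      (Finset.mem_sdiff.1 h2).1 (Finset.mem_sdiff.1 h3).1 ?_ ?_ ?_ ?_ ?_)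
    · simp [hne e₁ h1, n2, n3, h12, h13, h23]
    · intro x hx; simp [hx]
    · intro x hx; simp [hx]
    · intro x hx; by_cases x ∈ g e₁ <;> simp [*]
    · intro x hx; by_cases x ∈ g e₁ <;> simp [*]
    · have u1 := Finset.card_union_le (g e₁ ∪ e₁ ∪ (e₂ \ g e₁)) (e₃ \ g e₁)
      have u2 := Finset.card_union_le (g e₁ ∪ e₁) (e₂ \ g e₁)
      have u3 := hunion e₁ h1
      have u4 := Finset.card_sdiff_add_card_inter e₂ (g e₁)
      have u5 := Finset.card_sdiff_add_card_inter e₃ (g e₁)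
      rw [Finset.inter_comm, hT e₂ (Finset.mem_sdiff.1 h2).1] at u4
      rw [Finset.inter_comm, hT e₃ (Finset.mem_sdiff.1 h3).1] at u5
      omega
  -- Pairs f, `k f` for different partners f span disjoint sets of four points: two sets that meet
  -- would put four triples on 4 + 4 - 1 = 7 points.
  have hdisj : 4 * ((T \ L).image g).card ≤ Fintype.card α := by
    have hinv : ∀ f ∈ (T \ L).image g, ∃ e ∈ T \ L, g e = f := fun f hf => Finset.mem_image.1 hf
    choose! k hk hgk using hinv
    have h4 : ∀ f ∈ (T \ L).image g, 4 ≤ (f ∪ k f).card := by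
      intro f hf
      have hkf := hne _ (hk f hf)
      have hfT := hLT (hgL _ (hk f hf))
      rw [hgk f hf] at hkf hfT
      have hkT := hT _ (Finset.mem_sdiff.1 (hk f hf)).1
      by_contra! hlt
      have h1 := Finset.eq_of_subset_of_card_le (Finset.subset_union_left (s₁ := f) (s₂ := k f))
        (by rw [hT f hfT]; omega)
      have h2 := Finset.eq_of_subset_of_card_le (Finset.subset_union_right (s₁ := f) (s₂ := k f))
        (by rw [hkT]; omega)
      exact hkf (h1.trans h2.symm)
    have hpair : ((T \ L).image g : Set (Finset α)).PairwiseDisjoint fun f => f ∪ k f := by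
      intro f hf f' hf' hff
      rw [Finset.mem_coe] at hf hf'
      by_contra hnd
      rw [Function.onFun, Finset.disjoint_iff_inter_eq_empty] at hnd
      have hpos := Finset.card_pos.2 (Finset.nonempty_iff_ne_empty.2 hnd)
      have h1 := hk f hf
      have h2 := hk f' hf'
      have u1 := hunion _ h1
      have u2 := hunion _ h2
      rw [hgk f hf] at u1
      rw [hgk f' hf'] at u2
      have hfL := hgL _ h1
      have hfL' := hgL _ h2
      rw [hgk f hf] at hfL
      rw [hgk f' hf'] at hfL'
      rw [Finset.mem_sdiff] at h1 h2
      have u3 := Finset.card_union_add_card_inter (f ∪ k f) (f' ∪ k f')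
      refine h (.of_subset (e₁ := f) (e₂ := k f) (e₃ := f') (e₄ := k f')
        (U := (f ∪ k f) ∪ (f' ∪ k f')) ?_ (hLT hfL) h1.1 (hLT hfL') h2.1 ?_ ?_ ?_ ?_ (by omega))
      · have n1 : f ≠ k f := fun hh => h1.2 (hh ▸ hfL)
        have n2 : f ≠ k f' := fun hh => h2.2 (hh ▸ hfL)
        have n3 : k f ≠ f' := fun hh => h1.2 (hh ▸ hfL')
        have n4 : f' ≠ k f' := fun hh => h2.2 (hh ▸ hfL')
        have n5 : k f ≠ k f' := fun hh => hff (by rw [← hgk f hf, hh, hgk f' hf'])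
        simp [n1, n2, n3, n4, n5, hff]
      all_goals intro x hx; simp [hx]
    have h5 : ((T \ L).image g).card * 4 ≤ (((T \ L).image g).biUnion fun f => f ∪ k f).card := by
      rw [Finset.card_biUnion hpair, ← smul_eq_mul]
      exact Finset.card_nsmul_le_sum _ _ _ h4
    have h6 := Finset.card_le_univ (((T \ L).image g).biUnion fun f => f ∪ k f)
    omega
  have := Finset.card_sdiff_add_card_eq_card hLT
  omega

end FourOnSeven

/-! ### Four triples on seven points in a 3-partite system; random colourings -/

section Rainbow

lemma exists_color_eq {α : Type*} {χ : α → Fin 3} {e : Finset α} (he : e.card = 3)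
    (hχ : Set.InjOn χ (e : Set α)) (i : Fin 3) : ∃ x ∈ e, χ x = i := by
  have h1 : e.image χ = Finset.univ := by
    rw [← Finset.card_eq_iff_eq_univ, Finset.card_image_of_injOn hχ, he, Fintype.card_fin]
  exact Finset.mem_image.1 (h1 ▸ Finset.mem_univ i)

variable {α : Type*} [DecidableEq α] {T : Finset (Finset α)}

/-- A triangle together with a triple through the middle points of two of its sides. -/
lemma hasPasch_or_hasConfig14_of_triangle (hT : IsTripleSystem T) (hL : IsPartialLinear T)
    {p q r u v w : α} (hnd : [p, q, r, u, v, w].Nodup) (h1 : {p, q, u} ∈ T) (h2 : {p, r, v} ∈ T)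
    (h3 : {q, r, w} ∈ T) {e : Finset α} (he : e ∈ T) (hne1 : e ≠ {p, q, u}) (hne2 : e ≠ {p, r, v})
    (hu : u ∈ e) (hv : v ∈ e) : HasPasch T ∨ HasConfig14 T := by
  simp only [List.nodup_cons, List.mem_cons, List.not_mem_nil, or_false, not_or] at hnd
  obtain ⟨⟨hpq, hpr, hpu, hpv, hpw⟩, ⟨hqr, hqu, hqv, hqw⟩, ⟨hru, hrv, hrw⟩, ⟨huv, huw⟩, hvw, -⟩ := hnd
  obtain ⟨z, huz, hvz, rfl⟩ := exists_eq_triple_of_mem (hT e he) huv hu hv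
  have hzp : z ≠ p := by
    rintro rfl
    exact hne1 (hL _ he _ h1 u z huz (by simp) (by simp) (by simp) (by simp))
  have hzq : z ≠ q := by
    rintro rfl
    exact hne1 (hL _ he _ h1 u z huz (by simp) (by simp) (by simp) (by simp))
  have hzr : z ≠ r := by
    rintro rfl
    exact hne2 (hL _ he _ h2 v z hvz (by simp) (by simp) (by simp) (by simp))
  have h1' : {p, u, q} ∈ T := by rwa [Finset.pair_comm u q]
  have h3' : {q, w, r} ∈ T := by rwa [Finset.pair_comm w r]
  by_cases hzw : z = w
  · subst hzw
    refine Or.inl ⟨p, u, q, z, r, v, ?_, h1', h3', h2, ?_⟩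
    · simp only [List.nodup_cons, List.mem_cons, List.not_mem_nil, or_false, not_or]
      grind
    · rwa [Finset.pair_comm z v]
  · refine Or.inr ⟨p, u, q, w, r, v, z, ?_, h1', h3', h2, he⟩
    simp only [List.nodup_cons, List.mem_cons, List.not_mem_nil, or_false, not_or]
    grind

lemma IsPartialLinear.eq_of_mem (hL : IsPartialLinear T) {e f : Finset α} (he : e ∈ T) (hf : f ∈ T)
    (hef : e ≠ f) {x y : α} (hxe : x ∈ e) (hxf : x ∈ f) (hye : y ∈ e) (hyf : y ∈ f) : x = y := by
  by_contra hxy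
  exact hef (hL e he f hf x y hxy hxe hye hxf hyf)

/-- In a `3`-partite linear triple system, three concurrent triples and any fourth one span more
than seven points. -/
lemma seven_lt_card_of_concurrent (hT : IsTripleSystem T) (hL : IsPartialLinear T)
    {χ : α → Fin 3} (hχ : ∀ e ∈ T, Set.InjOn χ (e : Set α)) {e₁ e₂ e₃ e₄ : Finset α}
    (h₁ : e₁ ∈ T) (h₂ : e₂ ∈ T) (h₃ : e₃ ∈ T) (h₄ : e₄ ∈ T) (h12 : e₁ ≠ e₂) (h13 : e₁ ≠ e₃)
    (h14 : e₁ ≠ e₄) (h23 : e₂ ≠ e₃) (h24 : e₂ ≠ e₄) (h34 : e₃ ≠ e₄) {p : α}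
    (hp1 : p ∈ e₁) (hp2 : p ∈ e₂) (hp3 : p ∈ e₃) : 7 < (e₁ ∪ e₂ ∪ e₃ ∪ e₄).card := by
  by_contra! hcard
  have c1 : (e₁ ∩ e₂).card ≤ 1 := Finset.card_le_one.2 fun x hx y hy =>
    hL.eq_of_mem h₁ h₂ h12 (Finset.mem_inter.1 hx).1 (Finset.mem_inter.1 hx).2
      (Finset.mem_inter.1 hy).1 (Finset.mem_inter.1 hy).2
  have c2 : ((e₁ ∪ e₂) ∩ e₃).card ≤ 1 := by
    rw [← Finset.card_singleton p]
    refine Finset.card_le_card fun x hx => Finset.mem_singleton.2 ?_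
    obtain ⟨hx, hx3⟩ := Finset.mem_inter.1 hx
    rcases Finset.mem_union.1 hx with hx | hx
    · exact hL.eq_of_mem h₁ h₃ h13 hx hx3 hp1 hp3
    · exact hL.eq_of_mem h₂ h₃ h23 hx hx3 hp2 hp3
  have u1 := Finset.card_union_add_card_inter e₁ e₂
  have u2 := Finset.card_union_add_card_inter (e₁ ∪ e₂) e₃
  rw [hT _ h₁, hT _ h₂] at u1
  rw [hT _ h₃] at u2
  -- Three concurrent triples already cover seven points, so the fourth adds none.
  have hsub : e₄ ⊆ e₁ ∪ e₂ ∪ e₃ := by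
    rw [Finset.eq_of_subset_of_card_le (Finset.subset_union_left (s₁ := e₁ ∪ e₂ ∪ e₃) (s₂ := e₄))
      (by omega)]
    exact Finset.subset_union_right
  have hex : ∀ x ∈ e₄, ∃ f ∈ T, f ≠ e₄ ∧ x ∈ f ∧ p ∈ f := by
    intro x hx
    have := hsub hx
    simp only [Finset.mem_union] at this
    rcases this with (h | h) | h
    exacts [⟨e₁, h₁, h14, h, hp1⟩, ⟨e₂, h₂, h24, h, hp2⟩, ⟨e₃, h₃, h34, h, hp3⟩]
  obtain ⟨x, hx, hxp⟩ := exists_color_eq (hT _ h₄) (hχ _ h₄) (χ p)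
  obtain ⟨f, hf, -, hxf, hpf⟩ := hex x hx
  -- The point x of e₄ with the colour of p lies on a rainbow triple through p, so x = p. Any other
  -- point of e₄ is then joined to p by a second triple.
  obtain rfl := hχ f hf hxf hpf hxp
  obtain ⟨y, hy, hyx⟩ := Finset.exists_mem_ne (by rw [hT _ h₄]; omega : 1 < e₄.card) x
  obtain ⟨f', hf', hne, hyf, hxf'⟩ := hex y hy
  exact hyx (hL.eq_of_mem hf' h₄ hne hyf hy hxf' hx)

/-- Two of the six points of a triangle that lie on no common side are either two middle points or a
corner and the opposite middle point. The latter pair is monochromatic, hence excluded. -/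
lemma mem_middle_of_triangle {χ : α → Fin 3} {p q r u v w x y : α} {e : Finset α}
    (ku : χ u = χ r) (kv : χ v = χ q) (kw : χ w = χ p) (hxy : χ x ≠ χ y)
    (hx : x ∈ [p, q, r, u, v, w]) (hy : y ∈ [p, q, r, u, v, w]) (hxe : x ∈ e) (hye : y ∈ e)
    (n1 : ¬ (x ∈ ({p, q, u} : Finset α) ∧ y ∈ ({p, q, u} : Finset α)))
    (n2 : ¬ (x ∈ ({p, r, v} : Finset α) ∧ y ∈ ({p, r, v} : Finset α)))
    (n3 : ¬ (x ∈ ({q, r, w} : Finset α) ∧ y ∈ ({q, r, w} : Finset α))) :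
    (u ∈ e ∧ v ∈ e) ∨ (u ∈ e ∧ w ∈ e) ∨ (v ∈ e ∧ w ∈ e) := by
  simp only [List.mem_cons, List.not_mem_nil, or_false] at hx hy
  rcases hx with rfl | rfl | rfl | rfl | rfl | rfl <;>
    rcases hy with rfl | rfl | rfl | rfl | rfl | rfl <;>
    first
    | (refine absurd ⟨?_, ?_⟩ n1 <;> simp; done)
    | (refine absurd ⟨?_, ?_⟩ n2 <;> simp; done)
    | (refine absurd ⟨?_, ?_⟩ n3 <;> simp; done)
    | exact absurd ‹_› hxy
    | exact absurd (Eq.symm ‹_›) hxy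
    | simp [hxe, hye]

/-- The triangle has six points, so the fourth triple has at least two points among them. By the
colouring these can be taken to be middle points. -/
lemma hasPasch_or_hasConfig14_of_fourth_mem (hT : IsTripleSystem T) (hL : IsPartialLinear T)
    {χ : α → Fin 3} (hχ : ∀ e ∈ T, Set.InjOn χ (e : Set α)) {p q r u v w : α} {e₄ : Finset α}
    (hnd : [p, q, r, u, v, w].Nodup) (h₁ : {p, q, u} ∈ T) (h₂ : {p, r, v} ∈ T)
    (h₃ : {q, r, w} ∈ T) (h₄ : e₄ ∈ T) (h14 : {p, q, u} ≠ e₄) (h24 : {p, r, v} ≠ e₄)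
    (h34 : {q, r, w} ≠ e₄) (hcard : ({p, q, u} ∪ {p, r, v} ∪ {q, r, w} ∪ e₄ : Finset α).card ≤ 7) :
    HasPasch T ∨ HasConfig14 T := by
  obtain ⟨⟨hpq, hpr, hpu, hpv, hpw⟩, ⟨hqr, hqu, hqv, hqw⟩, ⟨hru, hrv, hrw⟩, ⟨huv, huw⟩, hvw⟩ :
      (p ≠ q ∧ p ≠ r ∧ p ≠ u ∧ p ≠ v ∧ p ≠ w) ∧ (q ≠ r ∧ q ≠ u ∧ q ≠ v ∧ q ≠ w) ∧
      (r ≠ u ∧ r ≠ v ∧ r ≠ w) ∧ (u ≠ v ∧ u ≠ w) ∧ v ≠ w := by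
    simpa [List.nodup_cons, not_or] using hnd
  have color : ∀ {a b c}, {a, b, c} ∈ T → a ≠ b → a ≠ c → b ≠ c →
      χ a ≠ χ b ∧ χ a ≠ χ c ∧ χ b ≠ χ c := fun {a b c} h hab hac hbc =>
    ⟨fun hh => hab (hχ _ h (by simp) (by simp) hh), fun hh => hac (hχ _ h (by simp) (by simp) hh),
      fun hh => hbc (hχ _ h (by simp) (by simp) hh)⟩
  have k1 := color h₁ hpq hpu hqu
  have k2 := color h₂ hpr hpv hrv
  have k3 := color h₃ hqr hqw hrw
  have ku : χ u = χ r := by omega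
  have kv : χ v = χ q := by omega
  have kw : χ w = χ p := by omega
  have hUeq : ({p, q, u} ∪ {p, r, v} ∪ {q, r, w} : Finset α) = [p, q, r, u, v, w].toFinset := by
    ext x; simp; tauto
  have hU : (({p, q, u} ∪ {p, r, v} ∪ {q, r, w} : Finset α)).card = 6 := by
    rw [hUeq, List.toFinset_card_of_nodup]
    · rfl
    · exact hnd
  have hI : 1 < (({p, q, u} ∪ {p, r, v} ∪ {q, r, w} : Finset α) ∩ e₄).card := by
    have := Finset.card_union_add_card_inter ({p, q, u} ∪ {p, r, v} ∪ {q, r, w} : Finset α) e₄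
    rw [hU, hT _ h₄] at this
    omega
  obtain ⟨x, hx, y, hy, hxy⟩ := Finset.one_lt_card.1 hI
  obtain ⟨hxU, hx4⟩ := Finset.mem_inter.1 hx
  obtain ⟨hyU, hy4⟩ := Finset.mem_inter.1 hy
  have n1 : ¬ (x ∈ ({p, q, u} : Finset α) ∧ y ∈ ({p, q, u} : Finset α)) :=
    fun hh => hxy (hL.eq_of_mem h₁ h₄ h14 hh.1 hx4 hh.2 hy4)
  have n2 : ¬ (x ∈ ({p, r, v} : Finset α) ∧ y ∈ ({p, r, v} : Finset α)) :=
    fun hh => hxy (hL.eq_of_mem h₂ h₄ h24 hh.1 hx4 hh.2 hy4)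
  have n3 : ¬ (x ∈ ({q, r, w} : Finset α) ∧ y ∈ ({q, r, w} : Finset α)) :=
    fun hh => hxy (hL.eq_of_mem h₃ h₄ h34 hh.1 hx4 hh.2 hy4)
  have n4 : χ x ≠ χ y := fun hh => hxy (hχ _ h₄ hx4 hy4 hh)
  have hmid : (u ∈ e₄ ∧ v ∈ e₄) ∨ (u ∈ e₄ ∧ w ∈ e₄) ∨ (v ∈ e₄ ∧ w ∈ e₄) := by
    refine mem_middle_of_triangle ku kv kw n4 ?_ ?_ hx4 hy4 n1 n2 n3
    · rwa [← List.mem_toFinset, ← hUeq]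
    · rwa [← List.mem_toFinset, ← hUeq]
  rcases hmid with ⟨ha, hb⟩ | ⟨ha, hb⟩ | ⟨ha, hb⟩
  · refine hasPasch_or_hasConfig14_of_triangle hT hL (p := p) (q := q) (r := r) (u := u) (v := v)
      (w := w) ?_ h₁ h₂ h₃ h₄ h14.symm h24.symm ha hb
    simp only [List.nodup_cons, List.mem_cons, List.not_mem_nil, or_false, not_or,
      List.nodup_nil, not_false_eq_true, and_true]
    refine ⟨⟨?_, ?_, ?_, ?_, ?_⟩, ⟨?_, ?_, ?_, ?_⟩, ⟨?_, ?_, ?_⟩, ⟨?_, ?_⟩, ?_⟩ <;>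
      assumption
  · rw [Finset.insert_comm] at h₁ h14
    refine hasPasch_or_hasConfig14_of_triangle hT hL (p := q) (q := p) (r := r) (u := u) (v := w)
      (w := v) ?_ h₁ h₃ h₂ h₄ h14.symm h34.symm ha hb
    simp only [List.nodup_cons, List.mem_cons, List.not_mem_nil, or_false, not_or,
      List.nodup_nil, not_false_eq_true, and_true]
    refine ⟨⟨?_, ?_, ?_, ?_, ?_⟩, ⟨?_, ?_, ?_, ?_⟩, ⟨?_, ?_, ?_⟩, ⟨?_, ?_⟩, ?_⟩ <;>
      first | assumption | (refine Ne.symm ?_; assumption)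
  · rw [Finset.insert_comm] at h₂ h24 h₃ h34
    refine hasPasch_or_hasConfig14_of_triangle hT hL (p := r) (q := p) (r := q) (u := v) (v := w)
      (w := u) ?_ h₂ h₃ h₁ h₄ h24.symm h34.symm ha hb
    simp only [List.nodup_cons, List.mem_cons, List.not_mem_nil, or_false, not_or,
      List.nodup_nil, not_false_eq_true, and_true]
    refine ⟨⟨?_, ?_, ?_, ?_, ?_⟩, ⟨?_, ?_, ?_, ?_⟩, ⟨?_, ?_, ?_⟩, ⟨?_, ?_⟩, ?_⟩ <;>
      first | assumption | (refine Ne.symm ?_; assumption)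

lemma hasPasch_or_hasConfig14_of_pairwise_meet (hT : IsTripleSystem T) (hL : IsPartialLinear T)
    {χ : α → Fin 3} (hχ : ∀ e ∈ T, Set.InjOn χ (e : Set α)) {e₁ e₂ e₃ e₄ : Finset α}
    (h₁ : e₁ ∈ T) (h₂ : e₂ ∈ T) (h₃ : e₃ ∈ T) (h₄ : e₄ ∈ T) (h12 : e₁ ≠ e₂) (h13 : e₁ ≠ e₃)
    (h14 : e₁ ≠ e₄) (h23 : e₂ ≠ e₃) (h24 : e₂ ≠ e₄) (h34 : e₃ ≠ e₄)
    (m12 : (e₁ ∩ e₂).Nonempty) (m13 : (e₁ ∩ e₃).Nonempty) (m23 : (e₂ ∩ e₃).Nonempty)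
    (hcard : (e₁ ∪ e₂ ∪ e₃ ∪ e₄).card ≤ 7) : HasPasch T ∨ HasConfig14 T := by
  obtain ⟨p, hp⟩ := m12
  obtain ⟨q, hq⟩ := m13
  obtain ⟨r, hr⟩ := m23
  obtain ⟨hp1, hp2⟩ := Finset.mem_inter.1 hp
  obtain ⟨hq1, hq3⟩ := Finset.mem_inter.1 hq
  obtain ⟨hr2, hr3⟩ := Finset.mem_inter.1 hr
  have hp3 : p ∉ e₃ := fun hp3 => hcard.not_gt
    (seven_lt_card_of_concurrent hT hL hχ h₁ h₂ h₃ h₄ h12 h13 h14 h23 h24 h34 hp1 hp2 hp3)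
  have hpq : p ≠ q := by rintro rfl; exact hp3 hq3
  have hpr : p ≠ r := by rintro rfl; exact hp3 hr3
  have hqr : q ≠ r := by rintro rfl; exact hpq (hL.eq_of_mem h₁ h₂ h12 hp1 hp2 hq1 hr2)
  obtain ⟨u, hpu, hqu, rfl⟩ := exists_eq_triple_of_mem (hT _ h₁) hpq hp1 hq1
  obtain ⟨v, hpv, hrv, rfl⟩ := exists_eq_triple_of_mem (hT _ h₂) hpr hp2 hr2
  obtain ⟨w, hqw, hrw, rfl⟩ := exists_eq_triple_of_mem (hT _ h₃) hqr hq3 hr3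
  have hur : u ≠ r := by
    rintro rfl; exact hpr (hL.eq_of_mem h₁ h₂ h12 hp1 hp2 (by simp) hr2)
  have huv : u ≠ v := by
    rintro rfl; exact hpu (hL.eq_of_mem h₁ h₂ h12 hp1 hp2 (by simp) (by simp))
  have huw : u ≠ w := by
    rintro rfl; exact hqu (hL.eq_of_mem h₁ h₃ h13 hq1 hq3 (by simp) (by simp))
  have hvq : v ≠ q := by
    rintro rfl; exact hpv (hL.eq_of_mem h₁ h₂ h12 hp1 hp2 hq1 (by simp))
  have hvw : v ≠ w := by
    rintro rfl; exact hrv (hL.eq_of_mem h₂ h₃ h23 hr2 hr3 (by simp) (by simp))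
  have hwp : w ≠ p := by
    rintro rfl; simp at hp3
  refine hasPasch_or_hasConfig14_of_fourth_mem hT hL hχ (p := p) (q := q) (r := r) (u := u) (v := v)
    (w := w) ?_ h₁ h₂ h₃ h₄ h14 h24 h34 hcard
  simp only [List.nodup_cons, List.mem_cons, List.not_mem_nil, or_false, not_or,
    List.nodup_nil, not_false_eq_true, and_true]
  refine ⟨⟨?_, ?_, ?_, ?_, ?_⟩, ⟨?_, ?_, ?_, ?_⟩, ⟨?_, ?_, ?_⟩, ⟨?_, ?_⟩, ?_⟩ <;>
    first | assumption | (refine Ne.symm ?_; assumption)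

/-- In a `3`-partite linear triple system, four triples on at most seven points form a Pasch
configuration or a `C₁₄`. -/
lemma HasFourOnSeven.hasPasch_or_hasConfig14 (hT : IsTripleSystem T) (hL : IsPartialLinear T)
    {χ : α → Fin 3} (hχ : ∀ e ∈ T, Set.InjOn χ (e : Set α)) (h : HasFourOnSeven T) :
    HasPasch T ∨ HasConfig14 T := by
  obtain ⟨S, hST, hS, hcard⟩ := h
  obtain ⟨e₁, e₂, e₃, e₄, h12, h13, h14, h23, h24, h34, rfl⟩ := Finset.card_eq_four.1 hS
  have h₁ : e₁ ∈ T := hST (by simp)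
  have h₂ : e₂ ∈ T := hST (by simp)
  have h₃ : e₃ ∈ T := hST (by simp)
  have h₄ : e₄ ∈ T := hST (by simp)
  have hU : (e₁ ∪ e₂ ∪ e₃ ∪ e₄).card ≤ 7 := by
    refine le_trans (le_of_eq (congrArg _ ?_)) hcard
    simp [Finset.union_assoc]
  have inter_le : ∀ e ∈ T, ∀ f ∈ T, e ≠ f → (e ∩ f).card ≤ 1 := by
    refine fun e he f hf hef => Finset.card_le_one.2 fun x hx y hy => ?_
    rw [Finset.mem_inter] at hx hy
    by_contra hxy
    exact hef (hL e he f hf x y hxy hx.1 hy.1 hx.2 hy.2)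
  have i12 := inter_le _ h₁ _ h₂ h12
  have i13 := inter_le _ h₁ _ h₃ h13
  have i14 := inter_le _ h₁ _ h₄ h14
  have i23 := inter_le _ h₂ _ h₃ h23
  have i24 := inter_le _ h₂ _ h₄ h24
  have i34 := inter_le _ h₃ _ h₄ h34
  have u1 := Finset.card_union_add_card_inter e₁ e₂
  have u2 := Finset.card_union_add_card_inter (e₁ ∪ e₂) e₃
  have u3 := Finset.card_union_add_card_inter (e₁ ∪ e₂ ∪ e₃) e₄
  have u4 : ((e₁ ∪ e₂) ∩ e₃).card ≤ (e₁ ∩ e₃).card + (e₂ ∩ e₃).card := by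
    rw [Finset.union_inter_distrib_right]
    exact Finset.card_union_le _ _
  have u5 : ((e₁ ∪ e₂ ∪ e₃) ∩ e₄).card ≤ (e₁ ∩ e₄).card + (e₂ ∩ e₄).card + (e₃ ∩ e₄).card := by
    rw [Finset.union_inter_distrib_right, Finset.union_inter_distrib_right]
    exact (Finset.card_union_le _ _).trans (Nat.add_le_add_right (Finset.card_union_le _ _) _)
  rw [hT _ h₁, hT _ h₂] at u1
  rw [hT _ h₃] at u2
  rw [hT _ h₄] at u3
  -- Four triples have 12 incidences, so spanning at most seven points forces five of the six pairs
  -- to meet. One disjoint pair cannot spoil all three choices of three triples containing e₁.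
  have hcases : (0 < (e₁ ∩ e₂).card ∧ 0 < (e₁ ∩ e₃).card ∧ 0 < (e₂ ∩ e₃).card) ∨
      (0 < (e₁ ∩ e₂).card ∧ 0 < (e₁ ∩ e₄).card ∧ 0 < (e₂ ∩ e₄).card) ∨
      (0 < (e₁ ∩ e₃).card ∧ 0 < (e₁ ∩ e₄).card ∧ 0 < (e₃ ∩ e₄).card) := by omega
  simp only [Finset.card_pos] at hcases
  rcases hcases with ⟨a, b, c⟩ | ⟨a, b, c⟩ | ⟨a, b, c⟩
  · exact hasPasch_or_hasConfig14_of_pairwise_meet hT hL hχ h₁ h₂ h₃ h₄ h12 h13 h14 h23 h24 h34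
      a b c hU
  · rw [Finset.union_right_comm] at hU
    exact hasPasch_or_hasConfig14_of_pairwise_meet hT hL hχ h₁ h₂ h₄ h₃ h12 h14 h13 h24 h23 h34.symm
      a b c hU
  · rw [Finset.union_right_comm, Finset.union_right_comm e₁, Finset.union_right_comm] at hU
    refine hasPasch_or_hasConfig14_of_pairwise_meet hT hL hχ h₁ h₃ h₄ h₂ h13 h14 h12 h34 h23.symm
      h24.symm a b c (le_trans (le_of_eq (congrArg _ ?_)) hU)
    ext x; simp; tauto

/-- Averaging over the nine shifts of the colours of b and c: each shift permutes the colourings,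
and for every colouring exactly two of its nine shifts are rainbow on a, b, c. -/
lemma nine_mul_card_rainbow [Fintype α] {a b c : α} (hab : a ≠ b) (hac : a ≠ c) (hbc : b ≠ c) :
    9 * (Finset.univ.filter fun χ : α → ZMod 3 => χ a ≠ χ b ∧ χ a ≠ χ c ∧ χ b ≠ χ c).card =
      2 * Fintype.card (α → ZMod 3) := by
  have h1 : ∀ s t : ZMod 3, ∑ χ : α → ZMod 3,
      (if χ a ≠ χ b + s ∧ χ a ≠ χ c + t ∧ χ b + s ≠ χ c + t then 1 else 0) =
      ∑ χ : α → ZMod 3, if χ a ≠ χ b ∧ χ a ≠ χ c ∧ χ b ≠ χ c then 1 else 0 := by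
    intro s t
    refine Fintype.sum_equiv (Equiv.addRight (Pi.single b s + Pi.single c t)) _ _ fun χ => ?_
    simp [hab, hac, hbc, hbc.symm]
  have h2 : ∀ x y z : ZMod 3, ∑ s : ZMod 3, ∑ t : ZMod 3,
      (if x ≠ y + s ∧ x ≠ z + t ∧ y + s ≠ z + t then 1 else 0) = 2 := by decide
  rw [Finset.card_filter]
  calc 9 * ∑ χ : α → ZMod 3, (if χ a ≠ χ b ∧ χ a ≠ χ c ∧ χ b ≠ χ c then 1 else 0)
      = ∑ s : ZMod 3, ∑ t : ZMod 3, ∑ χ : α → ZMod 3,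
        (if χ a ≠ χ b + s ∧ χ a ≠ χ c + t ∧ χ b + s ≠ χ c + t then 1 else 0) := by
        simp only [h1, Finset.sum_const, Finset.card_univ, ZMod.card, smul_eq_mul, ← mul_assoc]
        norm_num
    _ = ∑ χ : α → ZMod 3, ∑ s : ZMod 3, ∑ t : ZMod 3,
        (if χ a ≠ χ b + s ∧ χ a ≠ χ c + t ∧ χ b + s ≠ χ c + t then 1 else 0) := by
        rw [Finset.sum_comm]
        rw [Finset.sum_congr rfl fun t _ => Finset.sum_comm, Finset.sum_comm]
        refine Finset.sum_congr rfl fun χ _ => Finset.sum_comm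
    _ = 2 * Fintype.card (α → ZMod 3) := by
        rw [Finset.sum_congr rfl fun χ _ => h2 (χ a) (χ b) (χ c), Finset.sum_const,
          Finset.card_univ, smul_eq_mul, mul_comm]

/-- Some `3`-colouring of the points makes at least `2 / 9` of the triples rainbow. -/
lemma exists_rainbow_subset [Fintype α] (hT : IsTripleSystem T) :
    ∃ (χ : α → Fin 3) (R : Finset (Finset α)), R ⊆ T ∧ (∀ e ∈ R, Set.InjOn χ (e : Set α)) ∧
      2 * T.card ≤ 9 * R.card := by
  classical
  have hcount : ∀ e ∈ T, 9 * (Finset.univ.filter fun χ : α → ZMod 3 =>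
      Set.InjOn χ (e : Set α)).card = 2 * Fintype.card (α → ZMod 3) := by
    intro e he
    obtain ⟨a, b, c, hab, hac, hbc, rfl⟩ := Finset.card_eq_three.1 (hT e he)
    rw [← nine_mul_card_rainbow hab hac hbc]
    congr 2
    ext χ
    simp only [Finset.mem_filter, Finset.mem_univ, true_and]
    constructor
    · intro h
      exact ⟨fun hh => hab (h (by simp) (by simp) hh), fun hh => hac (h (by simp) (by simp) hh),
        fun hh => hbc (h (by simp) (by simp) hh)⟩
    · rintro ⟨h1, h2, h3⟩ x hx y hy hxy
      simp only [Finset.coe_insert, Finset.coe_singleton, Set.mem_insert_iff,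
        Set.mem_singleton_iff] at hx hy
      grind
  have hsum : ∑ _χ : α → ZMod 3, 2 * T.card ≤
      ∑ χ : α → ZMod 3, 9 * (T.filter fun e : Finset α => Set.InjOn χ (e : Set α)).card := by
    have hswap : ∑ χ : α → ZMod 3, 9 * (T.filter fun e : Finset α => Set.InjOn χ (e : Set α)).card =
        ∑ e ∈ T, 9 * (Finset.univ.filter fun χ : α → ZMod 3 => Set.InjOn χ (e : Set α)).card := by
      simp only [Finset.card_filter, Finset.mul_sum]
      exact Finset.sum_comm
    rw [hswap, Finset.sum_congr rfl hcount, Finset.sum_const, Finset.sum_const, Finset.card_univ,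
      smul_eq_mul, smul_eq_mul]
    exact le_of_eq (by ring)
  obtain ⟨χ, -, hχ⟩ := Finset.exists_le_of_sum_le Finset.univ_nonempty hsum
  -- `ZMod 3` unfolds to `Fin 3`, so the same colouring serves.
  exact ⟨χ, T.filter fun e => Set.InjOn χ (e : Set α), Finset.filter_subset _ _,
    fun e he => (Finset.mem_filter.1 he).2, hχ⟩

end Rainbow

/-! ### Bounds between the Turán numbers -/

section TuranNumbers

lemma nine_mul_linearTuranNumber_le {F : Set (Hypergraph ℕ)} (hF : fan3 ∈ F) (n : ℕ) :
    9 * linearTuranNumber 3 n F ≤ n ^ 2 := by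
  have : linearTuranNumber 3 n F ≤ n ^ 2 / 9 := by
    refine linearTuranNumber_le fun T hT hL hfree => ?_
    have := nine_mul_card_le hT hL fun h => hfree _ hF (contains_fan3.2 h)
    rw [Fintype.card_fin] at this
    omega
  omega

lemma linearTuranNumber_eq_of_transversal {G : Type*} [AddCommGroup G] [Fintype G] [DecidableEq G]
    {F : Set (Hypergraph ℕ)} (hF : fan3 ∈ F) (hfree : (ofFinsets (transversalTriples G)).IsFree F)
    {n : ℕ} (hn : n = 3 * Fintype.card G) : (linearTuranNumber 3 n F : ℝ) = (n : ℝ) ^ 2 / 9 := by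
  have h1 := card_le_linearTuranNumber isTripleSystem_transversalTriples
    isPartialLinear_transversalTriples hfree
  rw [Fintype.card_prod, Fintype.card_fin, ← hn] at h1
  have h2 := card_transversalTriples (G := G)
  have h3 := nine_mul_linearTuranNumber_le hF n
  have h4 : 9 * linearTuranNumber 3 n F = n ^ 2 := by
    refine le_antisymm h3 ?_
    calc n ^ 2 = 9 * (Fintype.card G * Fintype.card G) := by rw [hn]; ring
      _ ≤ 9 * linearTuranNumber 3 n F := Nat.mul_le_mul_left _ (h2.trans h1)
  have h5 : (9 * linearTuranNumber 3 n F : ℝ) = (n : ℝ) ^ 2 := by exact_mod_cast h4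
  linarith

lemma eq_zero_of_add_self_eq_zero {k : ℕ} (x : Fin k → ZMod 3) (h : x + x = 0) : x = 0 := by
  have key : ∀ a : ZMod 3, a + a = 0 → a = 0 := by decide
  exact funext fun i => key _ (congrFun h i)

lemma add_self_eq_zero_of_zmod_two {k : ℕ} (x : Fin k → ZMod 2) : x + x = 0 :=
  funext fun i => CharTwo.add_self_eq_zero (x i)

lemma turanNumber_le_linearTuranNumber_add (n : ℕ) :
    turanNumber 3 n fourTriplesSevenPoints ≤
      linearTuranNumber 3 n {fan3, pasch, config14} + n / 2 := by
  refine turanNumber_le fun T hT hfree => ?_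
  have h4 := not_hasFourOnSeven_of_isFree hT hfree
  obtain ⟨L, hLT, hL, hcard⟩ := exists_partialLinear_subset hT h4
  have h4L : ¬ HasFourOnSeven L := fun h => h4 (h.mono hLT)
  have hfreeL : (ofFinsets L).IsFree {fan3, pasch, config14} := by
    rintro G (rfl | rfl | rfl) hG
    · exact h4L (contains_fan3.1 hG).hasFourOnSeven
    · exact h4L (contains_pasch.1 hG).hasFourOnSeven
    · exact h4L (contains_config14.1 hG).hasFourOnSeven
  have := card_le_linearTuranNumber_fin (fun e he => hT e (hLT he)) hL hfreeL
  rw [Fintype.card_fin] at hcard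
  omega

lemma two_mul_linearTuranNumber_le (n : ℕ) :
    2 * linearTuranNumber 3 n {pasch, config14} ≤ 9 * turanNumber 3 n fourTriplesSevenPoints := by
  have : linearTuranNumber 3 n {pasch, config14} ≤
      9 * turanNumber 3 n fourTriplesSevenPoints / 2 := by
    refine linearTuranNumber_le fun T hT hL hfree => ?_
    obtain ⟨χ, R, hRT, hχ, hcard⟩ := exists_rainbow_subset hT
    have hR : IsTripleSystem R := fun e he => hT e (hRT he)
    have hRL : IsPartialLinear R := fun e he f hf => hL e (hRT he) f (hRT hf)
    have h4 : ¬ HasFourOnSeven R := by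
      intro h
      rcases h.hasPasch_or_hasConfig14 hR hRL hχ with h | h
      · obtain ⟨a, b, c, d, e, f, hnd, h1, h2, h3, h4⟩ := h
        exact hfree pasch (by simp) (contains_pasch.2
          ⟨a, b, c, d, e, f, hnd, hRT h1, hRT h2, hRT h3, hRT h4⟩)
      · obtain ⟨a, b, c, d, e, f, g, hnd, h1, h2, h3, h4⟩ := h
        exact hfree config14 (by simp) (contains_config14.2
          ⟨a, b, c, d, e, f, g, hnd, hRT h1, hRT h2, hRT h3, hRT h4⟩)
    have := card_le_turanNumber hR (isFree_fourTriplesSevenPoints_of_not h4)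
    omega
  omega

lemma linearTuranNumber_anti {β : Type*} {F F' : Set (Hypergraph β)} (h : F' ⊆ F) (n : ℕ) :
    linearTuranNumber 3 n F ≤ linearTuranNumber 3 n F' :=
  linearTuranNumber_le fun _ hT hL hfree =>
    card_le_linearTuranNumber_fin hT hL fun G hG => hfree G (h hG)

end TuranNumbers

/-! ### The six statements -/

theorem theorem4 :
    {n : ℕ | (linearTuranNumber 3 n {pasch} : ℝ) = (n : ℝ) * ((n : ℝ) - 1) / 6}.Infinite ∧
    {n : ℕ | (linearTuranNumber 3 n {config14} : ℝ) = (n : ℝ) * ((n : ℝ) - 1) / 6}.Infinite ∧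
    (∀ n : ℕ, 3 ∣ n → (linearTuranNumber 3 n {fan3} : ℝ) = (n : ℝ) ^ 2 / 9) ∧
    {n : ℕ | (linearTuranNumber 3 n {fan3, pasch} : ℝ) = (n : ℝ) ^ 2 / 9}.Infinite ∧
    {n : ℕ | (linearTuranNumber 3 n {fan3, config14} : ℝ) = (n : ℝ) ^ 2 / 9}.Infinite ∧
    (∀ n : ℕ,
      (turanNumber 3 n fourTriplesSevenPoints : ℝ) - (n : ℝ) / 2
          ≤ (linearTuranNumber 3 n {fan3, pasch, config14} : ℝ) ∧
      (linearTuranNumber 3 n {fan3, pasch, config14} : ℝ)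
          ≤ (linearTuranNumber 3 n {pasch, config14} : ℝ) ∧
      (linearTuranNumber 3 n {pasch, config14} : ℝ)
          ≤ 9 / 2 * (turanNumber 3 n fourTriplesSevenPoints : ℝ)) := by
  refine ⟨?_, ?_, ?_, ?_, ?_, fun n => ⟨?_, ?_, ?_⟩⟩
  · refine Set.infinite_of_injective_forall_mem (f := fun k : ℕ => 3 ^ k)
      (Nat.pow_right_injective (by norm_num)) fun k => ?_
    have hc : Fintype.card (Fin k → ZMod 3) = 3 ^ k := by simp
    rw [Set.mem_ofPred_eq, ← hc]
    refine linearTuranNumber_eq_of_covering isTripleSystem_zeroSumTriples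
      isPartialLinear_zeroSumTriples (zeroSumTriples_covers fun x => ?_) ?_
    · have key : ∀ a : ZMod 3, 3 • a = 0 := by decide
      exact funext fun i => key (x i)
    · rintro G rfl hG
      exact not_hasPasch_zeroSumTriples eq_zero_of_add_self_eq_zero (contains_pasch.1 hG)
  · refine Set.infinite_of_injective_forall_mem (f := fun k : ℕ => 2 ^ k - 1) ?_ fun k => ?_
    · intro a b hab
      have h1 := Nat.one_le_two_pow (n := a)
      have h2 := Nat.one_le_two_pow (n := b)
      exact Nat.pow_right_injective le_rfl (by simp only at hab ⊢; omega)
    · have hc : Fintype.card {x : Fin k → ZMod 2 // x ≠ 0} = 2 ^ k - 1 := by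
        simp [Fintype.card_subtype_compl]
      rw [Set.mem_ofPred_eq, ← hc]
      refine linearTuranNumber_eq_of_covering isTripleSystem_nonzeroZeroSumTriples
        isPartialLinear_nonzeroZeroSumTriples
        (nonzeroZeroSumTriples_covers add_self_eq_zero_of_zmod_two) ?_
      rintro G rfl hG
      exact not_hasConfig14_nonzeroZeroSumTriples add_self_eq_zero_of_zmod_two
        (contains_config14.1 hG)
  · rintro _ ⟨m, rfl⟩
    -- `ZMod 0` is infinite, so n = 0 is treated separately.
    rcases Nat.eq_zero_or_pos m with rfl | hm
    · have := nine_mul_linearTuranNumber_le (F := {fan3}) (Set.mem_singleton _) 0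
      have : linearTuranNumber 3 0 {fan3} = 0 := by omega
      simp [this]
    · have : NeZero m := ⟨hm.ne'⟩
      refine linearTuranNumber_eq_of_transversal (G := ZMod m) (Set.mem_singleton _) ?_ (by rw [ZMod.card])
      rintro G rfl hG
      exact not_hasFan3_transversalTriples (contains_fan3.1 hG)
  · refine Set.infinite_of_injective_forall_mem (f := fun k : ℕ => 3 * 3 ^ k) ?_ fun k => ?_
    · intro a b hab
      exact Nat.pow_right_injective (a := 3) (by norm_num)
        (Nat.eq_of_mul_eq_mul_left (by norm_num) hab)
    · refine linearTuranNumber_eq_of_transversal (G := Fin k → ZMod 3) (Or.inl rfl) ?_ (by simp)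
      rintro G (rfl | rfl) hG
      · exact not_hasFan3_transversalTriples (contains_fan3.1 hG)
      · exact not_hasPasch_transversalTriples eq_zero_of_add_self_eq_zero (contains_pasch.1 hG)
  · refine Set.infinite_of_injective_forall_mem (f := fun k : ℕ => 3 * 2 ^ k) ?_ fun k => ?_
    · intro a b hab
      exact Nat.pow_right_injective (a := 2) le_rfl
        (Nat.eq_of_mul_eq_mul_left (by norm_num) hab)
    · refine linearTuranNumber_eq_of_transversal (G := Fin k → ZMod 2) (Or.inl rfl) ?_ (by simp)
      rintro G (rfl | rfl) hG
      · exact not_hasFan3_transversalTriples (contains_fan3.1 hG)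
      · exact not_hasConfig14_transversalTriples add_self_eq_zero_of_zmod_two
          (contains_config14.1 hG)
  · have h1 := turanNumber_le_linearTuranNumber_add n
    have h2 : 2 * turanNumber 3 n fourTriplesSevenPoints ≤
        2 * linearTuranNumber 3 n {fan3, pasch, config14} + n := by omega
    have h3 : (2 * turanNumber 3 n fourTriplesSevenPoints : ℝ) ≤
        2 * linearTuranNumber 3 n {fan3, pasch, config14} + n := by exact_mod_cast h2
    linarith
  · exact_mod_cast linearTuranNumber_anti (Set.subset_insert _ _) n
  · have h : (2 * linearTuranNumber 3 n {pasch, config14} : ℝ) ≤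
        9 * turanNumber 3 n fourTriplesSevenPoints := by
      exact_mod_cast two_mul_linearTuranNumber_le n
    linarith
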